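/- Let $d\ge 1$ and let $\mathbb{S}$ be the unit sphere of $\mathbb{R}^d$ or of $\mathbb{C}^d$. **Real sphere.** For $k\ge0$ let $\mathrm{Harm}_k(\mathbb{S})$ be the space of restrictions to $\mathbb{S}$ of the real harmonic homogeneous polynomials of degree $k$ on $\mathbb{R}^d$, and for $L\subset\mathbb{N}=\{0,1,2,\ldots\}$ let $P_L=\bigoplus_{k\in L}\mathrm{Harm}_k(\mathbb{S})$. Let $Q_k=C_k^{(d/2)}-C_{k-2}^{(d/2)}$, where $C_n^{(\lambda)}(x)=\sum_{0\le j\le n/2}(-1)^j\frac{(\lambda)_{n-j}}{j!\,(n-2j)!}(2x)^{n-2j}$ are the Gegenbauer polynomials, with $(\lambda)_m=\lambda(\lambda+1)\cdots(\lambda+m-1)$ and $C_n^{(\lambda)}=0$ for $n<0$. A univariate function $F$ *gives a potential for* $P$ if there is a finite sum $\sum_k f_kQ_k$ with all $f_k\ge0$ such that $F(\langle x,y\rangle)=\sum_k f_kQ_k(\langle x,y\rangle)$ for all $x,y\in\mathbb{S}$, and $P=P_L$ with $L=\{k: f_k>0\}$. For $U,V\subset\mathbb{N}$ put $$U\cdot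 V=\bigcup_{k\in U,\ l\in V}\{k+l-2j:0\le j\le\min\{k,l\}\}.$$ **Complex sphere.** For $p,q\ge0$ let $H(p,q)$ be the space of restrictions to $\mathbb{S}$ of the harmonic polynomials on $\mathbb{C}^d$ that are homogeneous of degree $p$ in $z_1,\ldots,z_d$ and homogeneous of degree $q$ in $\overline{z_1},\ldots,\overline{z_d}$, and for $\tau\subset\mathbb{N}^2$ let $P_\tau=\bigoplus_{(p,q)\in\tau}H(p,q)$. Let $Q_{00}=1$ and, for $(p,q)\ne(0,0)$, $$Q_{pq}(z)=\frac{p+q+d-1}{(d-1)!}\sum_{j=0}^{\min\{p,q\}}(-1)^j\frac{(d+p+q-j-2)!}{j!\,(p-j)!\,(q-j)!}\,z^{p-j}\,\overline{z}^{\,q-j}.$$ A univariate function $F$ *gives a potential for* $P$ if there is a finite sum $\sum f_{pq}Q_{pq}$ with all $f_{pq}\ge0$ such that $F(\langle z,w\rangle)=\sum f_{pq}Q_{pq}(\langle z,w\rangle)$ for all $z,w\in\mathbb{S}$, and $P=P_\tau$ with $\tau=\{(p,q):f_{pq}>0\}$. For $U,V\subset\mathbb{N}^2$ put $$U\cdot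 V=\bigcup_{(p,q)\in U,\ (r,s)\in V}\{(p+r-j,\,q+s-j):0\le j\le\min\{p,s\}+\min\{q,r\}\}.$$ In both cases a constant term ($f_0$ or $f_{00}$) is allowed, and the index $0$ or $(0,0)$ belongs to $L$ or $\tau$ exactly when it is positive. **Theorem.** In the real case and in the complex case: if $F$ gives a potential for $P_U$ and $G$ gives a potential for $P_V$, then the product $FG$ gives a potential for a subspace $P$ of $P_{U\cdot V}$. If $d\ge3$ (in the real case as well as in the complex case), then $P$ can be taken to be all of $P_{U\cdot V}$. -/

import Mathlib

open MvPolynomial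

noncomputable section

namespace SphericalPotential

/-- The unit sphere of `𝕜^d` (used for `𝕜 = ℝ` and `𝕜 = ℂ`). -/
abbrev UnitSphere (𝕜 : Type) [RCLike 𝕜] (d : ℕ) : Type :=
  Metric.sphere (0 : EuclideanSpace 𝕜 (Fin d)) 1

/-! ### Spaces of harmonic polynomials on the real sphere -/

/-- The Laplacian `∑ᵢ ∂²/∂xᵢ²` on real polynomials in `d` variables. -/
def realLaplacian (d : ℕ) : MvPolynomial (Fin d) ℝ →ₗ[ℝ] MvPolynomial (Fin d) ℝ :=
  ∑ i : Fin d, (pderiv i).toLinearMap ∘ₗ (pderiv i).toLinearMap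

/-- Restriction of a real polynomial in `d` variables to the real unit sphere. -/
def realRestrict (d : ℕ) : MvPolynomial (Fin d) ℝ →ₗ[ℝ] (UnitSphere ℝ d → ℝ) :=
  LinearMap.pi fun x => (aeval fun i => x.1 i : MvPolynomial (Fin d) ℝ →ₐ[ℝ] ℝ).toLinearMap

/-- `Harm_k(𝕊)`: restrictions to the real sphere of the harmonic homogeneous polynomials of
degree `k`. -/
def realHarm (d k : ℕ) : Submodule ℝ (UnitSphere ℝ d → ℝ) :=
  (homogeneousSubmodule (Fin d) ℝ k ⊓ LinearMap.ker (realLaplacian d)).map (realRestrict d)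

/-- `P_L = ⨁_{k ∈ L} Harm_k(𝕊)`, as a space of functions on the real sphere. -/
def realSpace (d : ℕ) (L : Set ℕ) : Submodule ℝ (UnitSphere ℝ d → ℝ) :=
  ⨆ k ∈ L, realHarm d k

/-! ### Spaces of harmonic polynomials on the complex sphere -/

/-- The operator `∑ᵢ ∂²/∂zᵢ∂z̄ᵢ` (a quarter of the Laplacian of `ℂ^d ≅ ℝ^{2d}`) on polynomials
in `z₁, …, z_d` (the variables `Sum.inl i`) and `z̄₁, …, z̄_d` (the variables `Sum.inr i`). -/
def complexLaplacian (d : ℕ) :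
    MvPolynomial (Fin d ⊕ Fin d) ℂ →ₗ[ℂ] MvPolynomial (Fin d ⊕ Fin d) ℂ :=
  ∑ i : Fin d, (pderiv (Sum.inl i)).toLinearMap ∘ₗ (pderiv (Sum.inr i)).toLinearMap

/-- Restriction of a polynomial in `z` and `z̄` to the complex unit sphere. -/
def complexRestrict (d : ℕ) :
    MvPolynomial (Fin d ⊕ Fin d) ℂ →ₗ[ℂ] (UnitSphere ℂ d → ℂ) :=
  LinearMap.pi fun z =>
    (aeval (Sum.elim (fun i => z.1 i) (fun i => (starRingEnd ℂ) (z.1 i))) :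
      MvPolynomial (Fin d ⊕ Fin d) ℂ →ₐ[ℂ] ℂ).toLinearMap

/-- `Hom_{p,q}(ℂ^d)`: polynomials homogeneous of degree `p` in `z` and of degree `q` in `z̄`. -/
def bihomogeneous (d p q : ℕ) : Submodule ℂ (MvPolynomial (Fin d ⊕ Fin d) ℂ) :=
  weightedHomogeneousSubmodule ℂ (Sum.elim (fun _ => 1) (fun _ => 0) : Fin d ⊕ Fin d → ℕ) p ⊓
  weightedHomogeneousSubmodule ℂ (Sum.elim (fun _ => 0) (fun _ => 1) : Fin d ⊕ Fin d → ℕ) q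

/-- `H(p,q)`: restrictions to the complex sphere of the harmonic polynomials that are homogeneous
of degree `p` in `z` and of degree `q` in `z̄`. -/
def complexHarm (d p q : ℕ) : Submodule ℂ (UnitSphere ℂ d → ℂ) :=
  (bihomogeneous d p q ⊓ LinearMap.ker (complexLaplacian d)).map (complexRestrict d)

/-- `P_τ = ⨁_{(p,q) ∈ τ} H(p,q)`, as a space of functions on the complex sphere. -/
def complexSpace (d : ℕ) (τ : Set (ℕ × ℕ)) : Submodule ℂ (UnitSphere ℂ d → ℂ) :=
  ⨆ i ∈ τ, complexHarm d i.1 i.2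

/-! ### Gegenbauer polynomials -/

/-- The Gegenbauer (ultraspherical) polynomial
`C_n^{(l)}(x) = ∑_{j ≤ n/2} (-1)^j (l)_{n-j} / (j! (n-2j)!) (2x)^{n-2j}`,
where `(l)_m = l (l+1) ⋯ (l+m-1)`. -/
def gegenbauerC (l : ℝ) (n : ℕ) (x : ℝ) : ℝ :=
  ∑ j ∈ Finset.range (n / 2 + 1),
    (-1) ^ j * (ascPochhammer ℝ (n - j)).eval l / ((j.factorial : ℝ) * ((n - 2 * j).factorial : ℝ))
      * (2 * x) ^ (n - 2 * j)

/-- `Q_k^{(d)} = C_k^{(d/2)} - C_{k-2}^{(d/2)}` (with `C_n = 0` for `n < 0`), the Gegenbauer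
polynomial for which `Q_k^{(d)}(⟨x,y⟩)` is the reproducing kernel of `Harm_k` on the sphere. -/
def realQ (d k : ℕ) (x : ℝ) : ℝ :=
  gegenbauerC ((d : ℝ) / 2) k x - if 2 ≤ k then gegenbauerC ((d : ℝ) / 2) (k - 2) x else 0

/-- The complex Gegenbauer polynomial `Q_{pq}^{(d)}(z) = (p+q+d-1)/(d-1)! ·
∑_{j ≤ min p q} (-1)^j (d+p+q-j-2)! / (j! (p-j)! (q-j)!) z^{p-j} z̄^{q-j}`,
for which `Q_{pq}^{(d)}(⟨z,w⟩)` is the reproducing kernel of `H(p,q)` on the sphere.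
`Q_{00} = 1` is listed separately only because the formula reads `0 · (-1)!` there if `d = 1`;
in all other cases with `1 ≤ d` the natural number subtractions are exact. -/
def complexQ (d p q : ℕ) (z : ℂ) : ℂ :=
  if p = 0 ∧ q = 0 then 1 else
    ((p + q + d - 1 : ℕ) : ℂ) / ((d - 1).factorial : ℂ) *
      ∑ j ∈ Finset.range (min p q + 1),
        (-1) ^ j * ((d + p + q - j - 2).factorial : ℂ) /
            ((j.factorial : ℂ) * ((p - j).factorial : ℂ) * ((q - j).factorial : ℂ))
          * z ^ (p - j) * (starRingEnd ℂ) z ^ (q - j)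

/-! ### Potentials -/

/-- The univariate function `F` gives a potential for the space `P` of functions on the real
sphere: on the inner products of unit vectors, `F = ∑ f_k Q_k` (a finite sum) with all `f_k ≥ 0`,
and `P = P_L` for `L = {k : f_k > 0}`. A constant term `f_0` is allowed, and is recorded in `L`. -/
def GivesRealPotential (d : ℕ) (F : ℝ → ℝ) (P : Submodule ℝ (UnitSphere ℝ d → ℝ)) : Prop :=
  ∃ f : ℕ →₀ ℝ, (∀ k, 0 ≤ f k) ∧
    (∀ x y : UnitSphere ℝ d,
      F (inner ℝ x.1 y.1) = f.sum fun k c => c * realQ d k (inner ℝ x.1 y.1)) ∧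
    P = realSpace d {k | 0 < f k}

/-- The univariate function `F` gives a potential for the space `P` of functions on the complex
sphere: on the inner products of unit vectors, `F = ∑ f_{pq} Q_{pq}` (a finite sum) with all
`f_{pq} ≥ 0`, and `P = P_τ` for `τ = {(p,q) : f_{pq} > 0}`. A constant term `f_{00}` is allowed,
and is recorded in `τ`. -/
def GivesComplexPotential (d : ℕ) (F : ℂ → ℂ) (P : Submodule ℂ (UnitSphere ℂ d → ℂ)) : Prop :=
  ∃ f : ℕ × ℕ →₀ ℝ, (∀ i, 0 ≤ f i) ∧
    (∀ z w : UnitSphere ℂ d,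
      F (inner ℂ w.1 z.1) = f.sum fun i c => (c : ℂ) * complexQ d i.1 i.2 (inner ℂ w.1 z.1)) ∧
    P = complexSpace d {i | 0 < f i}

/-! ### Gegenbauer index products -/

/-- `k · l = {k + l - 2j : 0 ≤ j ≤ min k l}`. -/
def realIndexMul (k l : ℕ) : Set ℕ :=
  {m | ∃ j ≤ min k l, m = k + l - 2 * j}

/-- `U · V`, the union of the `k · l` over `k ∈ U`, `l ∈ V`. -/
def realIndexProd (U V : Set ℕ) : Set ℕ :=
  ⋃ k ∈ U, ⋃ l ∈ V, realIndexMul k l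

/-- `(p,q) · (r,s) = {(p+r-j, q+s-j) : 0 ≤ j ≤ min p s + min q r}`. -/
def complexIndexMul (a b : ℕ × ℕ) : Set (ℕ × ℕ) :=
  {m | ∃ j ≤ min a.1 b.2 + min a.2 b.1, m = (a.1 + b.1 - j, a.2 + b.2 - j)}

/-- `U · V`, the union of the `(p,q) · (r,s)` over `(p,q) ∈ U`, `(r,s) ∈ V`. -/
def complexIndexProd (U V : Set (ℕ × ℕ)) : Set (ℕ × ℕ) :=
  ⋃ a ∈ U, ⋃ b ∈ V, complexIndexMul a b

end SphericalPotential

end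

/-! Let `H i` be the spaces of spherical harmonics and `K i` the kernels `Q_i(⟨x,y⟩)`. The proof
rests on `K i` being the reproducing kernel of `H i` up to a positive factor: `K i (x,y) = ∑ Y_a(x)
conj(Y_a(y))` for a finite family `Y_a` spanning `H i`. A product `K i * K j` is a polynomial in the
inner product (and its conjugate), hence a real combination `∑ c_m K m`. Apply a linear functional
`φ` in `x` and its conjugate in `y`: `∑ |φ(Y_a Y_b)|² = ∑ c_m ∑ |φ(Y_{m,a})|²`. If `φ` kills every
`H n` with `n ≠ m` but not `H m`, only the term `c_m` survives. So `c_m ≥ 0`, and `c_m > 0` exactly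
when some product of an element of `H i` and one of `H j` has a nonzero component in `H m`.
Positivity thus becomes a question about products of harmonics (`kernel_product_coeff`,
`GivesPotential.mul`).

Upper bound: on the sphere, a coordinate times a harmonic polynomial is a sum of two harmonics, one
raised and one lowered in degree. Multiplying by one monomial at a time confines the product of `H
i` and `H j` to the indices in `i · j`.

Equality for `d ≥ 3`: let `B` be the quadratic form that is constant on the sphere and `Δ` its
Laplacian. If a homogeneous `P` of degree `N` has no component of degree `N - 2j` on the sphere,
then `P` is a sum of terms `B^i h` with `h` harmonic and `i ≠ j`, so `B` divides `Δ^j P`. It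
suffices to find harmonic `f`, `g` and a complex zero of `B` at which `Δ^j (f g)` does not vanish.
Here `f` and `g` involve two coordinates only, and the third is free to make `B` vanish.

The Fischer inner product, in which multiplication by a variable is adjoint to its derivative and so
`B` is adjoint to `Δ`, supplies two facts: a harmonic polynomial divisible by `B` is zero, and the
zonal polynomials reproduce harmonic polynomials. An involution `τ` of the variables treats both
spheres at once: the identity in the real case, the exchange of `z` and `z̄` in the complex case. -/

noncomputable section

namespace SphericalPotential

/-! ### The Fischer inner product -/

section Fischer

variable {𝕜 σ : Type*} [RCLike 𝕜] [Fintype σ]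

/-- The Fischer inner product `∑ α! conj(f_α) g_α` of two polynomials. -/
def fischer (f g : MvPolynomial σ 𝕜) : 𝕜 :=
  ∑ α ∈ f.support,
    (∏ s, ((α s).factorial : 𝕜)) * (starRingEnd 𝕜 (coeff α f) * coeff α g)

lemma fischer_eq_sum (f g : MvPolynomial σ 𝕜) {t : Finset (σ →₀ ℕ)} (ht : f.support ⊆ t) :
    fischer f g = ∑ α ∈ t,
      (∏ s, ((α s).factorial : 𝕜)) * (starRingEnd 𝕜 (coeff α f) * coeff α g) := by
  refine Finset.sum_subset ht fun α _ hα => ?_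
  rw [notMem_support_iff.1 hα]
  simp

lemma fischer_add_left (f₁ f₂ g : MvPolynomial σ 𝕜) :
    fischer (f₁ + f₂) g = fischer f₁ g + fischer f₂ g := by
  classical
  rw [fischer_eq_sum (f₁ + f₂) g (support_add (p := f₁) (q := f₂)),
    fischer_eq_sum f₁ g Finset.subset_union_left,
    fischer_eq_sum f₂ g Finset.subset_union_right, ← Finset.sum_add_distrib]
  refine Finset.sum_congr rfl fun α _ => ?_
  rw [coeff_add, map_add]
  ring

lemma fischer_add_right (f g₁ g₂ : MvPolynomial σ 𝕜) :
    fischer f (g₁ + g₂) = fischer f g₁ + fischer f g₂ := by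
  simp only [fischer, ← Finset.sum_add_distrib, coeff_add]
  exact Finset.sum_congr rfl fun α _ => by ring

lemma fischer_smul_right (c : 𝕜) (f g : MvPolynomial σ 𝕜) :
    fischer f (c • g) = c * fischer f g := by
  simp only [fischer, Finset.mul_sum, coeff_smul, smul_eq_mul]
  exact Finset.sum_congr rfl fun α _ => by ring

lemma fischer_conj_symm (f g : MvPolynomial σ 𝕜) :
    starRingEnd 𝕜 (fischer g f) = fischer f g := by
  classical
  rw [fischer_eq_sum f g (Finset.subset_union_left (s₂ := g.support)),
    fischer_eq_sum g f (Finset.subset_union_right (s₁ := f.support)), map_sum]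
  refine Finset.sum_congr rfl fun α _ => ?_
  simp only [map_mul, map_prod, map_natCast, RingHomCompTriple.comp_apply, RingHom.id_apply]
  ring

lemma fischer_smul_left (c : 𝕜) (f g : MvPolynomial σ 𝕜) :
    fischer (c • f) g = starRingEnd 𝕜 c * fischer f g := by
  rw [← fischer_conj_symm, fischer_smul_right, map_mul, fischer_conj_symm]

lemma fischer_zero_right (f : MvPolynomial σ 𝕜) : fischer f 0 = 0 := by
  simp [fischer]

lemma fischer_zero_left (g : MvPolynomial σ 𝕜) : fischer 0 g = 0 := by
  simp [fischer]

lemma fischer_sum_left {ι : Type*} (s : Finset ι) (f : ι → MvPolynomial σ 𝕜)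
    (g : MvPolynomial σ 𝕜) : fischer (∑ i ∈ s, f i) g = ∑ i ∈ s, fischer (f i) g := by
  classical
  induction s using Finset.induction_on with
  | empty => simp [fischer_zero_left]
  | insert a s ha ih => rw [Finset.sum_insert ha, Finset.sum_insert ha, fischer_add_left, ih]

lemma fischer_sum_right {ι : Type*} (s : Finset ι) (f : MvPolynomial σ 𝕜)
    (g : ι → MvPolynomial σ 𝕜) : fischer f (∑ i ∈ s, g i) = ∑ i ∈ s, fischer f (g i) := by
  classical
  induction s using Finset.induction_on with
  | empty => simp [fischer_zero_right]
  | insert a s ha ih => rw [Finset.sum_insert ha, Finset.sum_insert ha, fischer_add_right, ih]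

lemma fischer_self (f : MvPolynomial σ 𝕜) :
    fischer f f =
      ((∑ α ∈ f.support, (∏ s, ((α s).factorial : ℝ)) * ‖coeff α f‖ ^ 2 : ℝ) : 𝕜) := by
  simp only [fischer, RCLike.conj_mul]
  push_cast
  rfl

lemma fischer_self_re_nonneg (f : MvPolynomial σ 𝕜) : 0 ≤ RCLike.re (fischer f f) := by
  rw [fischer_self, RCLike.ofReal_re]
  positivity

lemma eq_zero_of_fischer_self (f : MvPolynomial σ 𝕜) (h : fischer f f = 0) : f = 0 := by
  rw [fischer_self, RCLike.ofReal_eq_zero, Finset.sum_eq_zero_iff_of_nonneg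
    (fun _ _ => by positivity)] at h
  by_contra hf
  obtain ⟨α, hα⟩ := support_nonempty.2 hf
  have h1 := h α hα
  have h2 : (∏ s, ((α s).factorial : ℝ)) ≠ 0 :=
    Finset.prod_ne_zero_iff.2 fun s _ => by positivity
  have h3 : ‖coeff α f‖ ≠ 0 := norm_ne_zero_iff.2 (mem_support_iff.1 hα)
  exact (mul_ne_zero h2 (pow_ne_zero 2 h3)) h1

lemma fischer_monomial_left (α : σ →₀ ℕ) (c : 𝕜) (g : MvPolynomial σ 𝕜) :
    fischer (monomial α c) g =
      (∏ s, ((α s).factorial : 𝕜)) * (starRingEnd 𝕜 c * coeff α g) := by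
  classical
  rw [fischer_eq_sum _ _ (support_monomial_subset), Finset.sum_singleton, coeff_monomial,
    if_pos rfl]

/-- On monomials: raising the exponent of `s` by one multiplies `α!` by `α s + 1`, which is the
factor produced by the derivative. -/
lemma fischer_X_mul_left (s : σ) (f g : MvPolynomial σ 𝕜) :
    fischer (X s * f) g = fischer f (pderiv s g) := by
  classical
  induction f using MvPolynomial.induction_on' with
  | monomial α c =>
    have h : X s * monomial α c = monomial (α + Finsupp.single s 1) c := by
      rw [X, monomial_mul, add_comm, one_mul]
    rw [h, fischer_monomial_left, fischer_monomial_left, coeff_pderiv]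
    have h2 : (∏ t, (((α + Finsupp.single s 1 : σ →₀ ℕ) t).factorial : 𝕜)) =
        (∏ t, ((α t).factorial : 𝕜)) * (α s + 1) := by
      rw [← Finset.mul_prod_erase _ _ (Finset.mem_univ s),
        ← Finset.mul_prod_erase _ (fun t => ((α t).factorial : 𝕜)) (Finset.mem_univ s)]
      simp only [Finsupp.add_apply]
      have : ∀ t ∈ Finset.univ.erase s, ((α t + Finsupp.single s 1 t).factorial : 𝕜) =
          ((α t).factorial : 𝕜) := fun t ht => by
        rw [Finsupp.single_eq_of_ne (Finset.ne_of_mem_erase ht), add_zero]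
      rw [Finset.prod_congr rfl this]
      simp [Nat.factorial_succ]
      ring
    rw [h2]
    ring
  | add p q hp hq => rw [mul_add, fischer_add_left, fischer_add_left, hp, hq]

end Fischer

/-! ### Quadratic forms and Laplacians attached to an involution -/

section Quadratic

lemma pderiv_comm {𝕜 σ : Type*} [RCLike 𝕜] (s t : σ) (f : MvPolynomial σ 𝕜) :
    pderiv s (pderiv t f) = pderiv t (pderiv s f) := by
  ext α
  simp only [coeff_pderiv]
  by_cases h : s = t
  · subst h; rfl
  · simp [Finsupp.single_eq_of_ne h, Finsupp.single_eq_of_ne (Ne.symm h), add_right_comm]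
    ring

variable {𝕜 σ : Type*} [RCLike 𝕜] [Fintype σ] (τ : σ → σ)

/-- The quadratic form `∑ₛ X_s X_{τ s}`. -/
def quad (𝕜 : Type*) {σ : Type*} [RCLike 𝕜] [Fintype σ] (τ : σ → σ) : MvPolynomial σ 𝕜 :=
  ∑ s, X s * X (τ s)

/-- The Laplacian `∑ₛ ∂_s ∂_{τ s}`. -/
def lap (𝕜 : Type*) {σ : Type*} [RCLike 𝕜] [Fintype σ] (τ : σ → σ) :
    MvPolynomial σ 𝕜 →ₗ[𝕜] MvPolynomial σ 𝕜 :=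
  ∑ s, (pderiv s).toLinearMap ∘ₗ (pderiv (τ s)).toLinearMap

lemma lap_apply (f : MvPolynomial σ 𝕜) : lap 𝕜 τ f = ∑ s, pderiv s (pderiv (τ s) f) := by
  simp [lap]

lemma fischer_quad_mul_left (f g : MvPolynomial σ 𝕜) :
    fischer (quad 𝕜 τ * f) g = fischer f (lap 𝕜 τ g) := by
  rw [quad, Finset.sum_mul, fischer_sum_left, lap_apply, fischer_sum_right]
  refine Finset.sum_congr rfl fun s _ => ?_
  rw [mul_assoc, fischer_X_mul_left, fischer_X_mul_left, pderiv_comm]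

/-- For `h = B q` adjointness gives `⟨h, h⟩ = ⟨q, Δ h⟩ = 0`, and the Fischer product is definite. -/
lemma eq_zero_of_lap_eq_zero_of_dvd {h : MvPolynomial σ 𝕜} (h0 : lap 𝕜 τ h = 0)
    (hd : quad 𝕜 τ ∣ h) : h = 0 := by
  obtain ⟨q, rfl⟩ := hd
  refine eq_zero_of_fischer_self _ ?_
  rw [fischer_quad_mul_left, h0, fischer_zero_right]

lemma isHomogeneous_quad : (quad 𝕜 τ).IsHomogeneous 2 :=
  IsHomogeneous.sum _ _ _ fun s _ => (isHomogeneous_X 𝕜 s).mul (isHomogeneous_X 𝕜 (τ s))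

variable {τ}

lemma pderiv_quad (hτ : Function.Involutive τ) (s : σ) :
    pderiv s (quad 𝕜 τ) = 2 * X (τ s) := by
  classical
  rw [quad, map_sum]
  simp only [pderiv_mul, pderiv_X, Pi.single_apply, Finset.sum_add_distrib]
  have h : ∀ x, (s = τ x) = (x = τ s) := fun x => by
    rw [eq_iff_iff]
    exact ⟨fun h => by rw [h, hτ], fun h => by rw [h, hτ]⟩
  simp [eq_comm]
  have : ∀ x, (s = τ x ↔ x = τ s) := fun x =>
    ⟨fun h => by rw [h, hτ], fun h => by rw [h, hτ]⟩
  simp [this]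
  ring

lemma lap_X_mul (hτ : Function.Involutive τ) (s : σ) (f : MvPolynomial σ 𝕜) :
    lap 𝕜 τ (X s * f) = 2 * pderiv (τ s) f + X s * lap 𝕜 τ f := by
  classical
  rw [lap_apply, lap_apply, Finset.mul_sum]
  have h : ∀ t, pderiv t (pderiv (τ t) (X s * f)) =
      (if t = τ s then pderiv t f else 0) + (if t = s then pderiv (τ t) f else 0) +
        X s * pderiv t (pderiv (τ t) f) := fun t => by
    have h1 : (s = τ t ↔ t = τ s) :=
      ⟨fun h => by rw [h, hτ], fun h => by rw [h, hτ]⟩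
    simp only [pderiv_mul, pderiv_X, Pi.single_apply, h1, map_add, @eq_comm _ s t]
    split_ifs <;> (simp <;> ring)
  simp only [h, Finset.sum_add_distrib, Finset.sum_ite_eq', Finset.mem_univ, if_true]
  ring

/-- Leibniz: the second derivatives of the form contribute `2 * card σ`, and the cross terms
contribute `4 * n` by Euler's identity. -/
lemma lap_quad_mul (hτ : Function.Involutive τ) {n : ℕ} {f : MvPolynomial σ 𝕜}
    (hf : f.IsHomogeneous n) :
    lap 𝕜 τ (quad 𝕜 τ * f) =
      ((2 * Fintype.card σ + 4 * n : ℕ) : 𝕜) • f + quad 𝕜 τ * lap 𝕜 τ f := by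
  have h : ∀ s, pderiv s (pderiv (τ s) (quad 𝕜 τ * f)) =
      2 * f + 2 * (X s * pderiv s f) + 2 * (X (τ s) * pderiv (τ s) f) +
        quad 𝕜 τ * pderiv s (pderiv (τ s) f) := fun s => by
    have h2 : pderiv s (2 : MvPolynomial σ 𝕜) = 0 := by
      rw [← map_ofNat C 2, pderiv_C]
    simp only [pderiv_mul, pderiv_quad hτ, map_add, hτ s, h2, pderiv_X_self]
    ring
  have e1 : ∑ s, X s * pderiv s f = (n : MvPolynomial σ 𝕜) * f := by
    rw [hf.sum_X_mul_pderiv, nsmul_eq_mul]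
  have e2 : ∑ s, X (τ s) * pderiv (τ s) f = (n : MvPolynomial σ 𝕜) * f := by
    rw [← e1]
    exact (Equiv.sum_comp (hτ.toPerm τ) fun s => X s * pderiv s f)
  rw [lap_apply, lap_apply, Finset.sum_congr rfl fun s _ => h s]
  simp only [Finset.sum_add_distrib, ← Finset.mul_sum, e1, e2, Finset.sum_const,
    Finset.card_univ, nsmul_eq_mul]
  rw [Nat.cast_smul_eq_nsmul, nsmul_eq_mul]
  push_cast
  ring

/-- The constant is the sum of `2 * card σ + 4 * (n + 2 * l)` over `l ≤ i`, one summand for each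
factor that the Laplacian passes. -/
lemma lap_quad_pow_mul (hτ : Function.Involutive τ) {n : ℕ} {f : MvPolynomial σ 𝕜}
    (hf : f.IsHomogeneous n) (i : ℕ) :
    lap 𝕜 τ (quad 𝕜 τ ^ (i + 1) * f) =
      (((i + 1) * (2 * Fintype.card σ + 4 * n + 4 * i) : ℕ) : 𝕜) • (quad 𝕜 τ ^ i * f) +
        quad 𝕜 τ ^ (i + 1) * lap 𝕜 τ f := by
  induction i with
  | zero => simpa using lap_quad_mul hτ hf
  | succ i ih =>
    have h1 : (quad 𝕜 τ ^ (i + 1) * f).IsHomogeneous (2 * (i + 1) + n) :=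
      ((isHomogeneous_quad τ).pow (i + 1)).mul hf
    rw [pow_succ' _ (i + 1), mul_assoc, lap_quad_mul hτ h1, ih]
    simp only [Nat.cast_smul_eq_nsmul, nsmul_eq_mul]
    push_cast
    ring

end Quadratic

/-! ### Harmonic polynomials restricted to a sphere -/

section Restriction

variable {𝕜 σ X : Type*} [RCLike 𝕜] [Fintype σ]

/-- Homogeneous polynomials of degree `n` in the kernel of the Laplacian of `τ`. -/
def harmonics (𝕜 : Type*) {σ : Type*} [RCLike 𝕜] [Fintype σ] (τ : σ → σ) (n : ℕ) :
    Submodule 𝕜 (MvPolynomial σ 𝕜) :=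
  homogeneousSubmodule σ 𝕜 n ⊓ LinearMap.ker (lap 𝕜 τ)

/-- Evaluation of polynomials at a family of points. -/
def restrict {𝕜 σ X : Type*} [RCLike 𝕜] (e : X → σ → 𝕜) :
    MvPolynomial σ 𝕜 →ₗ[𝕜] (X → 𝕜) :=
  LinearMap.pi fun x => (aeval (e x) : MvPolynomial σ 𝕜 →ₐ[𝕜] 𝕜).toLinearMap

lemma restrict_apply {𝕜 σ X : Type*} [RCLike 𝕜] (e : X → σ → 𝕜) (f : MvPolynomial σ 𝕜) (x : X) :
    restrict e f x = aeval (e x) f := rfl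

lemma restrict_mul {𝕜 σ X : Type*} [RCLike 𝕜] (e : X → σ → 𝕜) (f g : MvPolynomial σ 𝕜) :
    restrict e (f * g) = restrict e f * restrict e g := by
  ext x
  simp [restrict_apply]

variable {τ : σ → σ}

/-- Each Laplacian strips one factor `B` from `B^i h`, up to a scalar. For `k < i` a factor `B` is
left over; for `k > i` the Laplacian reaches `h` and gives zero. -/
lemma quad_dvd_lap_iterate (hτ : Function.Involutive τ) {t : ℕ} {h : MvPolynomial σ 𝕜}
    (hh : h ∈ harmonics 𝕜 τ t) {k i : ℕ} (hki : k ≠ i) :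
    quad 𝕜 τ ∣ (lap 𝕜 τ ^ k) (quad 𝕜 τ ^ i * h) := by
  induction k generalizing i with
  | zero =>
    obtain ⟨i, rfl⟩ := Nat.exists_eq_succ_of_ne_zero hki.symm
    exact ⟨quad 𝕜 τ ^ i * h, by rw [pow_zero, Module.End.one_apply, pow_succ']; ring⟩
  | succ k ih =>
    rw [pow_succ, Module.End.mul_apply]
    have h0 : lap 𝕜 τ h = 0 := hh.2
    rcases i with _ | i
    · rw [pow_zero, one_mul, h0, map_zero]
      exact dvd_zero _
    · rw [lap_quad_pow_mul hτ hh.1, h0, mul_zero, add_zero, map_smul]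
      rw [smul_eq_C_mul]
      exact (ih fun h => hki (by rw [h])).mul_left _

/-- Combinations of the `B^i h` of total degree `a`, with `B` the quadratic form of `τ` and `h`
harmonic of some degree in `T`. -/
def harmonicSums (𝕜 : Type*) {σ : Type*} [RCLike 𝕜] [Fintype σ] (τ : σ → σ) (T : Set ℕ) (a : ℕ) :
    Submodule 𝕜 (MvPolynomial σ 𝕜) :=
  Submodule.span 𝕜 {p | ∃ t ∈ T, ∃ i : ℕ, 2 * i + t = a ∧ ∃ h ∈ harmonics 𝕜 τ t,
    p = quad 𝕜 τ ^ i * h}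

variable {T : Set ℕ}

lemma harmonicSums_le_homogeneous (a : ℕ) :
    harmonicSums 𝕜 τ T a ≤ homogeneousSubmodule σ 𝕜 a := by
  refine Submodule.span_le.2 ?_
  rintro _ ⟨t, -, i, rfl, h, hh, rfl⟩
  exact ((isHomogeneous_quad τ).pow i).mul hh.1

lemma quad_mul_mem_harmonicSums {a : ℕ} {w : MvPolynomial σ 𝕜}
    (hw : w ∈ harmonicSums 𝕜 τ T a) : quad 𝕜 τ * w ∈ harmonicSums 𝕜 τ T (a + 2) := by
  refine Submodule.span_induction ?_ ?_ (fun x y _ _ hx hy => ?_) (fun c x _ hx => ?_) hw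
  · rintro _ ⟨t, ht, i, rfl, h, hh, rfl⟩
    exact Submodule.subset_span ⟨t, ht, i + 1, by ring, h, hh, by ring⟩
  · rw [mul_zero]; exact Submodule.zero_mem _
  · rw [mul_add]; exact Submodule.add_mem _ hx hy
  · rw [mul_smul_comm]; exact Submodule.smul_mem _ _ hx

lemma quad_pow_mul_mem_harmonicSums {a : ℕ} {w : MvPolynomial σ 𝕜}
    (hw : w ∈ harmonicSums 𝕜 τ T a) (M : ℕ) :
    quad 𝕜 τ ^ M * w ∈ harmonicSums 𝕜 τ T (a + 2 * M) := by
  induction M with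
  | zero => simpa using hw
  | succ M ih =>
    rw [pow_succ', mul_assoc]
    exact quad_mul_mem_harmonicSums ih

lemma exists_of_mem_harmonicSums {a : ℕ} {w : MvPolynomial σ 𝕜}
    (hw : w ∈ harmonicSums 𝕜 τ T (a + 2)) :
    ∃ h, lap 𝕜 τ h = 0 ∧ ∃ v ∈ harmonicSums 𝕜 τ T a, w = h + quad 𝕜 τ * v := by
  refine Submodule.span_induction ?_ ?_ (fun x y _ _ hx hy => ?_) (fun c x _ hx => ?_) hw
  · rintro _ ⟨t, ht, i, hi, h, hh, rfl⟩
    rcases i with _ | i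
    · exact ⟨h, hh.2, 0, Submodule.zero_mem _, by simp⟩
    · exact ⟨0, map_zero _, quad 𝕜 τ ^ i * h,
        Submodule.subset_span ⟨t, ht, i, by omega, h, hh, rfl⟩, by ring⟩
  · exact ⟨0, map_zero _, 0, Submodule.zero_mem _, by simp⟩
  · obtain ⟨h₁, hh₁, v₁, hv₁, rfl⟩ := hx
    obtain ⟨h₂, hh₂, v₂, hv₂, rfl⟩ := hy
    exact ⟨h₁ + h₂, by rw [map_add, hh₁, hh₂, add_zero], v₁ + v₂, Submodule.add_mem _ hv₁ hv₂,
      by ring⟩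
  · obtain ⟨h, hh, v, hv, rfl⟩ := hx
    exact ⟨c • h, by rw [map_smul, hh, smul_zero], c • v, Submodule.smul_mem _ _ hv,
      by rw [smul_add, mul_smul_comm]⟩

lemma quad_ne_zero [Nonempty σ] (hτ : Function.Involutive τ) : quad 𝕜 τ ≠ 0 := by
  intro h
  have h1 := lap_quad_mul (𝕜 := 𝕜) hτ (isHomogeneous_one σ 𝕜)
  rw [h] at h1
  simp only [zero_mul, map_zero, mul_zero, add_zero] at h1
  have h2 : ((2 * Fintype.card σ : ℕ) : 𝕜) = 0 := by
    simpa [smul_eq_C_mul] using h1.symm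
  rw [Nat.cast_eq_zero] at h2
  have := Fintype.card_pos (α := σ)
  omega

/-- Split off the terms without a factor `B`: they add up to a harmonic polynomial divisible by `B`,
hence to zero, and one factor `B` can be cancelled. -/
lemma mem_harmonicSums_of_quad_mul [Nonempty σ] (hτ : Function.Involutive τ) {a : ℕ} {q : MvPolynomial σ 𝕜}
    (hq : quad 𝕜 τ * q ∈ harmonicSums 𝕜 τ T (a + 2)) : q ∈ harmonicSums 𝕜 τ T a := by
  obtain ⟨h, hh, v, hv, hw⟩ := exists_of_mem_harmonicSums hq
  have h0 : h = 0 := eq_zero_of_lap_eq_zero_of_dvd τ hh ⟨q - v, by rw [mul_sub, hw]; ring⟩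
  rw [h0, zero_add] at hw
  rwa [mul_left_cancel₀ (quad_ne_zero hτ) hw]

lemma mem_harmonicSums_of_quad_pow_mul [Nonempty σ] (hτ : Function.Involutive τ) {a M : ℕ}
    {q : MvPolynomial σ 𝕜} (hq : quad 𝕜 τ ^ M * q ∈ harmonicSums 𝕜 τ T (a + 2 * M)) :
    q ∈ harmonicSums 𝕜 τ T a := by
  induction M with
  | zero => simpa using hq
  | succ M ih =>
    rw [pow_succ', mul_assoc] at hq
    exact ih (mem_harmonicSums_of_quad_mul hτ hq)

variable {e : X → σ → 𝕜} {ν : 𝕜}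

/-- Since `B` takes the constant value `ν ≠ 0`, multiplying by `B / ν` changes the degree by two and
not the restriction. Harmonics of equal parity can therefore be brought to one common degree. -/
lemma exists_harmonicSums_restrict_eq (hν : ν ≠ 0) (he : ∀ x, aeval (e x) (quad 𝕜 τ) = ν)
    {N : ℕ} (hT : ∀ t ∈ T, t % 2 = N % 2) {f : X → 𝕜}
    (hf : f ∈ ⨆ t ∈ T, (harmonics 𝕜 τ t).map (restrict e)) :
    ∃ M, ∃ w ∈ harmonicSums 𝕜 τ T (N + 2 * M), restrict e w = f := by
  have raise : ∀ M K : ℕ, ∀ w ∈ harmonicSums 𝕜 τ T (N + 2 * M),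
      ∃ v ∈ harmonicSums 𝕜 τ T (N + 2 * (M + K)), restrict e v = restrict e w := by
    intro M K w hw
    refine ⟨(ν ^ K)⁻¹ • (quad 𝕜 τ ^ K * w), Submodule.smul_mem _ _ ?_, ?_⟩
    · rw [mul_add, ← add_assoc]
      exact quad_pow_mul_mem_harmonicSums hw K
    · ext x
      simp only [map_smul, restrict_apply, map_mul, map_pow, he, smul_eq_mul]
      field_simp
  rw [iSup_subtype'] at hf
  refine Submodule.iSup_induction _ (motive := fun f => ∃ M,
    ∃ w ∈ harmonicSums 𝕜 τ T (N + 2 * M), restrict e w = f) hf ?_ ?_ ?_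
  · rintro ⟨t, ht⟩ _ ⟨h, hh, rfl⟩
    have hp := hT t ht
    -- `N + t` is even, so `B^((N+t)/2) h` has degree `N + 2t`, which is `N + 2M` for `M = t`.
    refine ⟨t, (ν ^ ((N + t) / 2))⁻¹ • (quad 𝕜 τ ^ ((N + t) / 2) * h),
      Submodule.smul_mem _ _ (Submodule.subset_span ⟨t, ht, (N + t) / 2, by omega, h, hh, rfl⟩), ?_⟩
    ext x
    simp only [map_smul, restrict_apply, map_mul, map_pow, he, smul_eq_mul]
    field_simp
  · exact ⟨0, 0, Submodule.zero_mem _, map_zero _⟩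
  · rintro _ _ ⟨M₁, w₁, hw₁, rfl⟩ ⟨M₂, w₂, hw₂, rfl⟩
    obtain ⟨v₁, hv₁, h₁⟩ := raise M₁ M₂ w₁ hw₁
    obtain ⟨v₂, hv₂, h₂⟩ := raise M₂ M₁ w₂ hw₂
    rw [add_comm M₂] at hv₂
    exact ⟨M₁ + M₂, v₁ + v₂, Submodule.add_mem _ hv₁ hv₂, by rw [map_add, h₁, h₂]⟩

/-- If the restriction of a homogeneous polynomial `P` has no harmonic component of degree
`deg P - 2j`, then `Δ^j P` is divisible by the quadratic form. -/
lemma quad_dvd_lap_iterate_of_restrict_mem [Nonempty σ] (hτ : Function.Involutive τ) (hν : ν ≠ 0)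
    (he : ∀ x, aeval (e x) (quad 𝕜 τ) = ν)
    (hzero : ∀ n, ∀ f : MvPolynomial σ 𝕜, f.IsHomogeneous n → restrict e f = 0 → f = 0)
    {N j : ℕ} {P : MvPolynomial σ 𝕜} (hP : P.IsHomogeneous N)
    (hmem : restrict e P ∈ ⨆ t ∈ {t | t % 2 = N % 2 ∧ t + 2 * j ≠ N},
      (harmonics 𝕜 τ t).map (restrict e)) :
    quad 𝕜 τ ∣ (lap 𝕜 τ ^ j) P := by
  obtain ⟨M, w, hw, hwP⟩ := exists_harmonicSums_restrict_eq hν he (fun t ht => ht.1) hmem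
  -- Both sides are homogeneous of degree `N + 2M` with the same restriction, so they agree as
  -- polynomials.
  have h1 : quad 𝕜 τ ^ M * P = ν ^ M • w := by
    refine sub_eq_zero.1 (hzero (N + 2 * M) _ ?_ ?_)
    · refine IsHomogeneous.sub ?_ ?_
      · rw [add_comm]
        exact ((isHomogeneous_quad τ).pow M).mul hP
      · exact (homogeneousSubmodule σ 𝕜 _).smul_mem _ (harmonicSums_le_homogeneous _ hw)
    · rw [map_sub, map_smul, hwP]
      ext x
      simp only [Pi.sub_apply, Pi.smul_apply, restrict_apply, map_mul, map_pow, he,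
        smul_eq_mul, sub_self, Pi.zero_apply]
  have h2 : P ∈ harmonicSums 𝕜 τ {t | t % 2 = N % 2 ∧ t + 2 * j ≠ N} N := by
    refine mem_harmonicSums_of_quad_pow_mul hτ (M := M) ?_
    rw [h1]
    exact Submodule.smul_mem _ _ hw
  -- A generator `B^i h` has `2i + t = N`, so `t + 2j ≠ N` says that `i ≠ j`.
  refine Submodule.span_induction (p := fun x _ => quad 𝕜 τ ∣ (lap 𝕜 τ ^ j) x) ?_ ?_
    (fun x y _ _ hx hy => ?_) (fun c x _ hx => ?_) h2
  · rintro _ ⟨t, ht, i, hi, h, hh, rfl⟩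
    refine quad_dvd_lap_iterate hτ hh ?_
    rintro rfl
    exact ht.2 (by omega)
  · rw [map_zero]; exact dvd_zero _
  · rw [map_add]; exact dvd_add hx hy
  · rw [map_smul, smul_eq_C_mul]; exact hx.mul_left _

/-- A function in an eigenspace of `R` that is a sum of elements of eigenspaces `H i` is a sum of
elements of those `H i` that belong to the same eigenvalue. -/
lemma mem_iSup_of_mem_eigenspace {ι V : Type*} [AddCommGroup V] [Module 𝕜 V]
    (R : Module.End 𝕜 V) (H : ι → Submodule 𝕜 V) (μ : ι → 𝕜) (hH : ∀ i, H i ≤ R.eigenspace (μ i))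
    {μ₀ : 𝕜} {s : Set ι} {f : V} (hf : f ∈ R.eigenspace μ₀) (hfs : f ∈ ⨆ i ∈ s, H i) :
    f ∈ ⨆ i ∈ {i | i ∈ s ∧ μ i = μ₀}, H i := by
  -- Split `f` into a part with eigenvalue `μ₀` and a part from the other eigenvalues; the second
  -- lies in independent eigenspaces, so it is zero.
  have h1 : ⨆ i ∈ s, H i ≤
      (⨆ i ∈ {i | i ∈ s ∧ μ i = μ₀}, H i) ⊔ ⨆ μ' ≠ μ₀, R.eigenspace μ' := by
    refine iSup₂_le fun i hi => ?_
    by_cases h : μ i = μ₀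
    · exact le_sup_of_le_left (le_iSup₂_of_le i ⟨hi, h⟩ le_rfl)
    · exact le_sup_of_le_right (le_iSup₂_of_le (μ i) h (hH i))
  obtain ⟨a, ha, b, hb, rfl⟩ := Submodule.mem_sup.1 (h1 hfs)
  have h2 : (⨆ i ∈ {i | i ∈ s ∧ μ i = μ₀}, H i) ≤ R.eigenspace μ₀ :=
    iSup₂_le fun i hi => hi.2 ▸ hH i
  have h3 : b ∈ R.eigenspace μ₀ := by
    simpa using Submodule.sub_mem _ hf (h2 ha)
  have h4 : b = 0 := by
    have := (R.eigenspaces_iSupIndep μ₀).le_bot ⟨h3, hb⟩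
    simpa using this
  rwa [h4, add_zero]

end Restriction

/-! ### Products of reproducing kernels -/

section Kernel

variable {𝕜 X ι : Type*} [RCLike 𝕜]

/-- `K(x,y) = ∑ Y_a(x) conj(Y_a(y))` for some finite family `Y_a` that spans `H`. -/
def IsKernelOf (H : Submodule 𝕜 (X → 𝕜)) (K : X → X → 𝕜) : Prop :=
  ∃ (n : ℕ) (Y : Fin n → X → 𝕜), Submodule.span 𝕜 (Set.range Y) = H ∧
    ∀ x y, K x y = ∑ a, Y a x * starRingEnd 𝕜 (Y a y)

lemma IsKernelOf.eq_zero {K : X → X → 𝕜} (h : IsKernelOf (⊥ : Submodule 𝕜 (X → 𝕜)) K) : K = 0 := by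
  obtain ⟨n, Y, hY, hK⟩ := h
  have h0 : ∀ a, Y a = 0 := fun a => by
    simpa [hY] using Submodule.subset_span (R := 𝕜) (Set.mem_range_self (f := Y) a)
  ext x y
  simp [hK, h0]

/-- The kernel identity is tested against `φ` in the variable `x` and the conjugate of `φ` in the
variable `y`. No positivity of the weights `w` is needed. -/
lemma sum_norm_sq_eq_of_kernel_eq {α β : Type*} [Fintype α] [Fintype β] (F : α → X → 𝕜)
    (G : β → X → 𝕜) (w : β → ℝ)
    (h : ∀ x y, ∑ a, F a x * starRingEnd 𝕜 (F a y) =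
      ∑ b, (w b : 𝕜) * (G b x * starRingEnd 𝕜 (G b y))) (φ : (X → 𝕜) →ₗ[𝕜] 𝕜) :
    ∑ a, ‖φ (F a)‖ ^ 2 = ∑ b, w b * ‖φ (G b)‖ ^ 2 := by
  have h1 : ∀ y, ∑ a, starRingEnd 𝕜 (F a y) • F a =
      ∑ b, ((w b : 𝕜) * starRingEnd 𝕜 (G b y)) • G b := fun y => by
    ext x
    simp only [Finset.sum_apply, Pi.smul_apply, smul_eq_mul]
    rw [Finset.sum_congr rfl fun a _ => mul_comm _ _, h x y]
    exact Finset.sum_congr rfl fun b _ => by ring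
  -- Apply `φ` in `x` and conjugate: this is again an identity of functions, now of `y`, to which
  -- `φ` applies a second time.
  have h2 : ∑ a, starRingEnd 𝕜 (φ (F a)) • F a =
      ∑ b, ((w b : 𝕜) * starRingEnd 𝕜 (φ (G b))) • G b := by
    ext y
    have := congrArg (fun f => starRingEnd 𝕜 (φ f)) (h1 y)
    simp only [map_sum, map_smul, smul_eq_mul, map_mul, RingHomCompTriple.comp_apply,
      RingHom.id_apply, RCLike.conj_ofReal] at this
    simp only [Finset.sum_apply, Pi.smul_apply, smul_eq_mul]
    rw [Finset.sum_congr rfl fun a _ => mul_comm _ _, this]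
    exact Finset.sum_congr rfl fun b _ => by ring
  have h3 := congrArg φ h2
  simp only [map_sum, map_smul, smul_eq_mul, RCLike.conj_mul, mul_assoc] at h3
  exact_mod_cast h3

/-- `A` and `B` are the sums of `‖φ‖ ^ 2` over the family spanning `H m` and over the products of
the families spanning `H i` and `H j`. Every other term of the expansion vanishes by the choice of
`φ`. The sign and the vanishing of `c m` can then be read off from `B = c m * A`. -/
lemma kernel_product_coeff {H : ι → Submodule 𝕜 (X → 𝕜)} {K : ι → X → X → 𝕜}
    (hK : ∀ i, IsKernelOf (H i) (K i)) {i j : ι} {c : ι →₀ ℝ}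
    (hc : K i * K j = Finsupp.linearCombination ℝ K c) (m : ι) (φ : (X → 𝕜) →ₗ[𝕜] 𝕜)
    (hφ : ∀ n ≠ m, ∀ f ∈ H n, φ f = 0) :
    ∃ A B : ℝ, 0 ≤ A ∧ 0 ≤ B ∧ B = c m * A ∧ (A = 0 → ∀ f ∈ H m, φ f = 0) ∧
      (B = 0 ↔ ∀ f ∈ H i, ∀ g ∈ H j, φ (f * g) = 0) := by
  choose N Y hY hKY using hK
  have hYm : ∀ n a, Y n a ∈ H n := fun n a => by
    rw [← hY n]
    exact Submodule.subset_span (Set.mem_range_self a)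
  have hvan : ∀ n, (∀ a, φ (Y n a) = 0) → ∀ f ∈ H n, φ f = 0 := fun n h f hf => by
    have : H n ≤ LinearMap.ker φ := by
      rw [← hY n, Submodule.span_le]
      rintro _ ⟨a, rfl⟩
      exact h a
    exact this hf
  have key := sum_norm_sq_eq_of_kernel_eq (α := Fin (N i) × Fin (N j))
    (β := (n : c.support) × Fin (N n)) (fun p => Y i p.1 * Y j p.2) (fun p => Y p.1 p.2)
    (fun p => c p.1) (fun x y => by
      have h1 := congrFun (congrFun hc x) y
      rw [Finsupp.linearCombination_apply, Finsupp.sum] at h1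
      simp only [Pi.mul_apply, Finset.sum_apply, Pi.smul_apply, hKY] at h1
      rw [Fintype.sum_sigma, Fintype.sum_prod_type]
      simp only [← Finset.mul_sum]
      rw [Finset.univ_eq_attach,
        Finset.sum_attach c.support fun n => (c n : 𝕜) * ∑ a, Y n a x * starRingEnd 𝕜 (Y n a y)]
      simp only [RCLike.real_smul_eq_coe_mul] at h1
      rw [← h1, Finset.sum_mul_sum]
      refine Finset.sum_congr rfl fun a _ => Finset.sum_congr rfl fun b _ => ?_
      simp only [Pi.mul_apply, map_mul]
      ring) φ
  refine ⟨∑ a, ‖φ (Y m a)‖ ^ 2, ∑ p : Fin (N i) × Fin (N j), ‖φ (Y i p.1 * Y j p.2)‖ ^ 2,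
    by positivity, by positivity, ?_, ?_, ?_, ?_⟩
  · rw [key, Fintype.sum_sigma]
    simp only [← Finset.mul_sum]
    rw [Finset.univ_eq_attach,
      Finset.sum_attach c.support fun n => c n * ∑ a, ‖φ (Y n a)‖ ^ 2]
    refine Finset.sum_eq_single m (fun n _ hn => ?_) (fun hm => ?_)
    · rw [Finset.sum_eq_zero, mul_zero]
      intro a _
      rw [hφ n hn _ (hYm n a)]
      simp
    · rw [Finsupp.notMem_support_iff.1 hm, zero_mul]
  · intro h
    refine hvan m fun a => ?_
    have := (Finset.sum_eq_zero_iff_of_nonneg fun _ _ => by positivity).1 h a (Finset.mem_univ a)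
    simpa using this
  · intro h f hf g hg
    have h0 : ∀ a b, φ (Y i a * Y j b) = 0 := fun a b => by
      have := (Finset.sum_eq_zero_iff_of_nonneg fun _ _ => by positivity).1 h (a, b)
        (Finset.mem_univ _)
      simpa using this
    have h1 : ∀ b, ∀ f ∈ H i, φ (f * Y j b) = 0 := fun b f hf => by
      have : H i ≤ LinearMap.ker (φ ∘ₗ LinearMap.mulRight 𝕜 (Y j b)) := by
        rw [← hY i, Submodule.span_le]
        rintro _ ⟨a, rfl⟩
        exact h0 a b
      exact this hf
    have : H j ≤ LinearMap.ker (φ ∘ₗ LinearMap.mulLeft 𝕜 f) := by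
      rw [← hY j, Submodule.span_le]
      rintro _ ⟨b, rfl⟩
      exact h1 b f hf
    exact this hg
  · intro h
    refine Finset.sum_eq_zero fun p _ => ?_
    rw [h _ (hYm i p.1) _ (hYm j p.2)]
    simp

lemma exists_linearMap_of_iSupIndep {H : ι → Submodule 𝕜 (X → 𝕜)} (hH : iSupIndep H) {m : ι}
    (hm : H m ≠ ⊥) : ∃ φ : (X → 𝕜) →ₗ[𝕜] 𝕜, (⨆ n ≠ m, H n) ≤ LinearMap.ker φ ∧
      ∃ f ∈ H m, φ f ≠ 0 := by
  obtain ⟨f, hf, hf0⟩ := Submodule.exists_mem_ne_zero_of_ne_bot hm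
  have hn : f ∉ ⨆ n ≠ m, H n := fun h => hf0 (by simpa using (hH m).le_bot ⟨hf, h⟩)
  obtain ⟨φ, hφf, hφ⟩ := Submodule.exists_le_ker_of_notMem hn
  exact ⟨φ, hφ, f, hf, hφf⟩

lemma kernel_product_coeff_nonneg {H : ι → Submodule 𝕜 (X → 𝕜)} {K : ι → X → X → 𝕜}
    (hK : ∀ i, IsKernelOf (H i) (K i)) {i j : ι} {c : ι →₀ ℝ}
    (hc : K i * K j = Finsupp.linearCombination ℝ K c) (hH : iSupIndep H) {m : ι}
    (hm : H m ≠ ⊥) : 0 ≤ c m := by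
  obtain ⟨φ, hφ, f, hf, hφf⟩ := exists_linearMap_of_iSupIndep hH hm
  obtain ⟨A, B, hA, hB, h, h1, -⟩ := kernel_product_coeff hK hc m φ
    fun n hnm g hg => hφ (Submodule.mem_iSup_of_mem n (Submodule.mem_iSup_of_mem hnm hg))
  have hA' : 0 < A := lt_of_le_of_ne hA fun h0 => hφf (h1 h0.symm f hf)
  exact nonneg_of_mul_nonneg_left (h ▸ hB) hA'

lemma kernel_product_coeff_pos {H : ι → Submodule 𝕜 (X → 𝕜)} {K : ι → X → X → 𝕜}
    (hK : ∀ i, IsKernelOf (H i) (K i)) {i j : ι} {c : ι →₀ ℝ}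
    (hc : K i * K j = Finsupp.linearCombination ℝ K c) {m : ι} {f g : X → 𝕜}
    (hf : f ∈ H i) (hg : g ∈ H j) (hfg : f * g ∉ ⨆ n ≠ m, H n) : 0 < c m := by
  obtain ⟨φ, hφf, hφ⟩ := Submodule.exists_le_ker_of_notMem hfg
  obtain ⟨A, B, hA, hB, h, -, h2⟩ := kernel_product_coeff hK hc m φ
    fun n hnm g hg => hφ (Submodule.mem_iSup_of_mem n (Submodule.mem_iSup_of_mem hnm hg))
  have hB' : 0 < B := lt_of_le_of_ne hB fun h0 => hφf (h2.1 h0.symm f hf g hg)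
  exact pos_of_mul_pos_left (h ▸ hB') hA

lemma exists_mul_notMem_of_kernel_product_coeff_ne_zero {H : ι → Submodule 𝕜 (X → 𝕜)}
    {K : ι → X → X → 𝕜} (hK : ∀ i, IsKernelOf (H i) (K i)) {i j : ι} {c : ι →₀ ℝ}
    (hc : K i * K j = Finsupp.linearCombination ℝ K c) (hH : iSupIndep H) {m : ι}
    (hm : H m ≠ ⊥) (hcm : c m ≠ 0) : ∃ f ∈ H i, ∃ g ∈ H j, f * g ∉ ⨆ n ≠ m, H n := by
  obtain ⟨φ, hφ, f, hf, hφf⟩ := exists_linearMap_of_iSupIndep hH hm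
  obtain ⟨A, B, hA, hB, h, h1, h2⟩ := kernel_product_coeff hK hc m φ
    fun n hnm g hg => hφ (Submodule.mem_iSup_of_mem n (Submodule.mem_iSup_of_mem hnm hg))
  have hA' : A ≠ 0 := fun h0 => hφf (h1 h0 f hf)
  by_contra! hall
  have hB0 : B ≠ 0 := by rw [h]; exact mul_ne_zero hcm hA'
  exact hB0 (h2.2 fun f hf g hg => hφ (hall f hf g hg))

/-- `F` is a finite combination of the kernels `K i` with nonnegative coefficients, and `P` is the
sum of the `H i` with positive coefficient. -/
def GivesPotential (H : ι → Submodule 𝕜 (X → 𝕜)) (K : ι → X → X → 𝕜) (F : X → X → 𝕜)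
    (P : Submodule 𝕜 (X → 𝕜)) : Prop :=
  ∃ f : ι →₀ ℝ, (∀ i, 0 ≤ f i) ∧ F = Finsupp.linearCombination ℝ K f ∧ P = ⨆ i ∈ {i | 0 < f i}, H i

/-- A sum of the spaces determines its index set only up to indices with `H i = ⊥`; these do occur
in low dimension, such as `Harm_k` with `k ≥ 2` for `d = 1`. -/
lemma mem_of_iSup_le_iSup {H : ι → Submodule 𝕜 (X → 𝕜)} (hH : iSupIndep H) {U V : Set ι}
    (h : ⨆ i ∈ U, H i ≤ ⨆ i ∈ V, H i) {i : ι} (hi : H i ≠ ⊥) (hiU : i ∈ U) : i ∈ V := by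
  by_contra hiV
  refine hi ((hH i).eq_bot_of_le ?_)
  refine (le_iSup₂_of_le i hiU le_rfl).trans (h.trans (iSup₂_le fun n hn => ?_))
  exact le_iSup₂_of_le n (fun hni => hiV (hni ▸ hn)) le_rfl

/-- A kernel of the zero space is zero, so its coefficient is irrelevant. -/
lemma linearCombination_filter_ne_bot {H : ι → Submodule 𝕜 (X → 𝕜)} {K : ι → X → X → 𝕜}
    (hK : ∀ i, IsKernelOf (H i) (K i)) (f : ι →₀ ℝ) [DecidablePred fun i => H i ≠ ⊥] :
    Finsupp.linearCombination ℝ K (f.filter fun i => H i ≠ ⊥) =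
      Finsupp.linearCombination ℝ K f := by
  have h0 : Finsupp.linearCombination ℝ K (f.filter fun i => ¬ H i ≠ ⊥) = 0 := by
    rw [Finsupp.linearCombination_apply, Finsupp.sum]
    refine Finset.sum_eq_zero fun i hi => ?_
    have h : H i = ⊥ := by
      by_contra h
      rw [Finsupp.support_filter, Finset.mem_filter] at hi
      exact hi.2 h
    have := hK i
    rw [h] at this
    rw [this.eq_zero, smul_zero]
  conv_rhs => rw [← Finsupp.filter_add_filter_not f fun i => H i ≠ ⊥, map_add, h0, add_zero]

/-- The product of two potentials is a potential, when the products of the spaces `H i`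
decompose according to `M`. -/
theorem GivesPotential.mul {H : ι → Submodule 𝕜 (X → 𝕜)} {K : ι → X → X → 𝕜}
    (hK : ∀ i, IsKernelOf (H i) (K i)) (hH : iSupIndep H)
    (hprod : ∀ i j, K i * K j ∈ Submodule.span ℝ (Set.range K)) {M : ι → ι → Set ι}
    (hM : ∀ i j, ∀ f ∈ H i, ∀ g ∈ H j, f * g ∈ ⨆ n ∈ M i j, H n) {F G : X → X → 𝕜} {U V : Set ι}
    (hF : GivesPotential H K F (⨆ i ∈ U, H i)) (hG : GivesPotential H K G (⨆ i ∈ V, H i)) :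
    ∃ P, GivesPotential H K (F * G) P ∧ P ≤ ⨆ n ∈ ⋃ i ∈ U, ⋃ j ∈ V, M i j, H n ∧
      ((∀ i j, ∀ m ∈ M i j, ∃ f ∈ H i, ∃ g ∈ H j, f * g ∉ ⨆ n ≠ m, H n) →
        P = ⨆ n ∈ ⋃ i ∈ U, ⋃ j ∈ V, M i j, H n) := by
  classical
  obtain ⟨f, hf0, rfl, hfU⟩ := hF
  obtain ⟨g, hg0, rfl, hgV⟩ := hG
  simp only [Finsupp.mem_span_range_iff_exists_finsupp] at hprod
  choose c hc using hprod
  have hc' : ∀ i j, K i * K j = Finsupp.linearCombination ℝ K (c i j) := fun i j => (hc i j).symm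
  -- A product with a nonzero component in `H m` forces `m` to be an admissible index and all three
  -- spaces to be nonzero.
  have hMm : ∀ i j m, (∃ f ∈ H i, ∃ g ∈ H j, f * g ∉ ⨆ n ≠ m, H n) → m ∈ M i j ∧ H m ≠ ⊥ ∧
      H i ≠ ⊥ ∧ H j ≠ ⊥ := by
    rintro i j m ⟨f, hf, g, hg, hfg⟩
    refine ⟨?_, ?_, ?_, ?_⟩
    · by_contra hm
      refine hfg ((iSup₂_le fun n hn => ?_ : ⨆ n ∈ M i j, H n ≤ _) (hM i j f hf g hg))
      exact le_iSup₂_of_le n (fun h : n = m => hm (h ▸ hn)) le_rfl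
    · intro hm
      refine hfg ((iSup₂_le fun n hn => ?_ : ⨆ n ∈ M i j, H n ≤ _) (hM i j f hf g hg))
      by_cases h : n = m
      · rw [h, hm]
        exact bot_le
      · exact le_iSup₂_of_le n h le_rfl
    · intro hi
      rw [hi, Submodule.mem_bot] at hf
      exact hfg (by rw [hf, zero_mul]; exact Submodule.zero_mem _)
    · intro hj
      rw [hj, Submodule.mem_bot] at hg
      exact hfg (by rw [hg, mul_zero]; exact Submodule.zero_mem _)
  set f' := f.filter fun i => H i ≠ ⊥ with hf'
  set g' := g.filter fun i => H i ≠ ⊥ with hg'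
  set h₀ : ι →₀ ℝ := f'.sum fun i a => g'.sum fun j b => (a * b) • c i j with hh₀
  have hf'0 : ∀ i, 0 ≤ f' i := fun i => by
    rw [hf', Finsupp.filter_apply]; split_ifs <;> [exact hf0 i; exact le_rfl]
  have hg'0 : ∀ i, 0 ≤ g' i := fun i => by
    rw [hg', Finsupp.filter_apply]; split_ifs <;> [exact hg0 i; exact le_rfl]
  have hval : ∀ m, h₀ m = ∑ i ∈ f'.support, ∑ j ∈ g'.support, f' i * g' j * c i j m := fun m => by
    simp [hh₀, Finsupp.sum, Finsupp.finsetSum_apply]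
  have hc0 : ∀ i j m, H m ≠ ⊥ → 0 ≤ c i j m := fun i j m hm =>
    kernel_product_coeff_nonneg hK (hc' i j) hH hm
  have hterm : ∀ m, H m ≠ ⊥ → ∀ i j, 0 ≤ f' i * g' j * c i j m := fun m hm i j =>
    mul_nonneg (mul_nonneg (hf'0 i) (hg'0 j)) (hc0 i j m hm)
  -- The sign of the coefficients is controlled only where `H m` is nonzero; the others are dropped
  -- without changing the function.
  set h := h₀.filter fun i => H i ≠ ⊥ with hh
  have hh0 : ∀ m, 0 ≤ h m := fun m => by
    rw [hh, Finsupp.filter_apply]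
    split_ifs with hm
    · rw [hval]
      exact Finset.sum_nonneg fun i _ => Finset.sum_nonneg fun j _ => hterm m hm i j
    · exact le_rfl
  have hsub : ⨆ i ∈ {i | 0 < h i}, H i ≤ ⨆ n ∈ ⋃ i ∈ U, ⋃ j ∈ V, M i j, H n := by
    refine iSup₂_le fun m hm => ?_
    rw [Set.mem_ofPred_eq, hh, Finsupp.filter_apply] at hm
    split_ifs at hm with hmb
    · rw [hval] at hm
      -- A positive coefficient of the product comes from some `c i j m ≠ 0`, hence from an actual
      -- product of harmonics with a component in `H m`.
      obtain ⟨i, hi, hi2⟩ := Finset.exists_ne_zero_of_sum_ne_zero hm.ne'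
      obtain ⟨j, hj, hj2⟩ := Finset.exists_ne_zero_of_sum_ne_zero hi2
      obtain ⟨hmM, -, hib, hjb⟩ := hMm i j m (exists_mul_notMem_of_kernel_product_coeff_ne_zero hK
        (hc' i j) hH hmb (right_ne_zero_of_mul hj2))
      have hfi : 0 < f i := lt_of_le_of_ne (hf0 i) fun h0 => by
        refine (Finsupp.mem_support_iff.1 hi) ?_
        rw [hf', Finsupp.filter_apply, ← h0, ite_self]
      have hgj : 0 < g j := lt_of_le_of_ne (hg0 j) fun h0 => by
        refine (Finsupp.mem_support_iff.1 hj) ?_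
        rw [hg', Finsupp.filter_apply, ← h0, ite_self]
      have hiU : i ∈ U := mem_of_iSup_le_iSup hH hfU.ge hib hfi
      have hjV : j ∈ V := mem_of_iSup_le_iSup hH hgV.ge hjb hgj
      exact le_iSup₂_of_le m (Set.mem_biUnion hiU (Set.mem_biUnion hjV hmM)) le_rfl
    · exact absurd hm (lt_irrefl 0)
  refine ⟨⨆ i ∈ {i | 0 < h i}, H i, ⟨h, hh0, ?_, rfl⟩, hsub, fun hE => le_antisymm hsub ?_⟩
  · have ef : Finsupp.linearCombination ℝ K f' = _ := linearCombination_filter_ne_bot hK f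
    have eg : Finsupp.linearCombination ℝ K g' = _ := linearCombination_filter_ne_bot hK g
    have eh : Finsupp.linearCombination ℝ K h = _ := linearCombination_filter_ne_bot hK h₀
    rw [← ef, ← eg, eh, hh₀]
    rw [Finsupp.linearCombination_apply, Finsupp.linearCombination_apply, Finsupp.sum, Finsupp.sum,
      Finset.sum_mul_sum, Finsupp.sum, map_sum]
    refine Finset.sum_congr rfl fun i _ => ?_
    rw [Finsupp.sum, map_sum]
    refine Finset.sum_congr rfl fun j _ => ?_
    rw [map_smul, ← hc', smul_mul_smul_comm]
  · refine iSup₂_le fun m hm => ?_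
    simp only [Set.mem_iUnion] at hm
    obtain ⟨i, hiU, j, hjV, hm⟩ := hm
    obtain ⟨u, hu, v, hv, huv⟩ := hE i j m hm
    obtain ⟨-, hmb, hib, hjb⟩ := hMm i j m ⟨u, hu, v, hv, huv⟩
    have hcm := kernel_product_coeff_pos hK (hc' i j) hu hv huv
    have hfi : 0 < f' i := by
      rw [hf', Finsupp.filter_apply, if_pos hib]
      exact mem_of_iSup_le_iSup hH hfU.le hib hiU
    have hgj : 0 < g' j := by
      rw [hg', Finsupp.filter_apply, if_pos hjb]
      exact mem_of_iSup_le_iSup hH hgV.le hjb hjV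
    refine le_iSup₂_of_le m ?_ le_rfl
    rw [Set.mem_ofPred_eq, hh, Finsupp.filter_apply, if_pos hmb, hval]
    -- All summands are nonnegative, so nothing cancels the positive one found for `(i, j)`.
    refine Finset.sum_pos' (fun i _ => Finset.sum_nonneg fun j _ => hterm m hmb i j)
      ⟨i, Finsupp.mem_support_iff.2 hfi.ne', Finset.sum_pos' (fun j _ => hterm m hmb i j)
        ⟨j, Finsupp.mem_support_iff.2 hgj.ne', by positivity⟩⟩

end Kernel

/-! ### Reproducing kernels of spaces of harmonic polynomials -/

section Reproducing

variable {𝕜 σ E : Type*} [RCLike 𝕜] [Fintype σ]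

/-- The `b a` form an orthonormal basis of `S` for the Fischer product. -/
lemma exists_fischer_expansion (S : Submodule 𝕜 (MvPolynomial σ 𝕜)) [FiniteDimensional 𝕜 S] :
    ∃ (n : ℕ) (b : Fin n → MvPolynomial σ 𝕜), (∀ a, b a ∈ S) ∧
      ∀ v ∈ S, v = ∑ a, fischer (b a) v • b a := by
  let core : InnerProductSpace.Core 𝕜 S :=
    { inner := fun f g => fischer f.1 g.1
      conj_inner_symm := fun f g => fischer_conj_symm f.1 g.1
      re_inner_nonneg := fun f => fischer_self_re_nonneg f.1
      add_left := fun f g h => fischer_add_left f.1 g.1 h.1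
      smul_left := fun f g c => fischer_smul_left c f.1 g.1
      definite := fun f hf => Subtype.ext (eq_zero_of_fischer_self f.1 hf) }
  let _ : NormedAddCommGroup S := core.toNormedAddCommGroup
  let _ : InnerProductSpace 𝕜 S := InnerProductSpace.ofCore core.toCore
  let b := stdOrthonormalBasis 𝕜 S
  refine ⟨_, fun a => (b a : MvPolynomial σ 𝕜), fun a => (b a).2, fun v hv => ?_⟩
  have h := congrArg Subtype.val (b.sum_repr' ⟨v, hv⟩).symm
  rw [AddSubmonoidClass.coe_finsetSum] at h
  exact h

/-- Expanding `Z y` in a Fischer orthonormal basis `b`, the reproducing property makes the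
coefficients `C conj(b_a(y))`. The value at `x` is then `C ∑ b_a(x) conj(b_a(y))`, and `√C` is
absorbed into the basis. -/
lemma isKernelOf_of_reproducing (S : Submodule 𝕜 (MvPolynomial σ 𝕜)) [FiniteDimensional 𝕜 S]
    (e : E → σ → 𝕜) (Z : E → MvPolynomial σ 𝕜) (hZ : ∀ y, Z y ∈ S) {C : ℝ} (hC : 0 < C)
    (hrep : ∀ y, ∀ h ∈ S, fischer (Z y) h = C * aeval (e y) h) :
    IsKernelOf (S.map (restrict e)) fun x y => aeval (e x) (Z y) := by
  obtain ⟨n, b, hb, hexp⟩ := exists_fischer_expansion S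
  have hC' : ((√C : ℝ) : 𝕜) ≠ 0 := RCLike.ofReal_ne_zero.2 (Real.sqrt_pos.2 hC).ne'
  refine ⟨n, fun a => ((√C : ℝ) : 𝕜) • restrict e (b a), le_antisymm ?_ ?_, fun x y => ?_⟩
  · rw [Submodule.span_le]
    rintro _ ⟨a, rfl⟩
    exact Submodule.smul_mem _ _ (Submodule.mem_map_of_mem (hb a))
  · rintro _ ⟨v, hv, rfl⟩
    rw [hexp v hv, map_sum]
    refine Submodule.sum_mem _ fun a _ => ?_
    rw [map_smul]
    refine Submodule.smul_mem _ _ ?_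
    have := Submodule.smul_mem _ ((√C : ℝ) : 𝕜)⁻¹ (Submodule.subset_span (R := 𝕜)
      (Set.mem_range_self (f := fun a => ((√C : ℝ) : 𝕜) • restrict e (b a)) a))
    simpa only [smul_smul, inv_mul_cancel₀ hC', one_smul] using this
  · have h1 : ((√C : ℝ) : 𝕜) * ((√C : ℝ) : 𝕜) = (C : 𝕜) := by
      rw [← RCLike.ofReal_mul, Real.mul_self_sqrt hC.le]
    change aeval (e x) (Z y) = _
    conv_lhs => rw [hexp _ (hZ y), map_sum]
    refine Finset.sum_congr rfl fun a _ => ?_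
    rw [map_smul, ← fischer_conj_symm, hrep y _ (hb a)]
    simp only [Pi.smul_apply, restrict_apply, smul_eq_mul, map_mul, RCLike.conj_ofReal, ← h1]
    ring

/-- The linear form with coefficients `a`. -/
def linForm {𝕜 σ : Type*} [RCLike 𝕜] [Fintype σ] (a : σ → 𝕜) : MvPolynomial σ 𝕜 :=
  ∑ s, C (a s) * X s

lemma pderiv_linForm (a : σ → 𝕜) (s : σ) : pderiv s (linForm a) = C (a s) := by
  classical
  simp [linForm, pderiv_X, Pi.single_apply]

lemma aeval_linForm (a v : σ → 𝕜) : aeval v (linForm a) = ∑ s, a s * v s := by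
  simp [linForm]

lemma isWeightedHomogeneous_linForm {w : σ → ℕ} {a : σ → 𝕜} {n : ℕ} (h : ∀ s, a s ≠ 0 → w s = n) :
    (linForm a).IsWeightedHomogeneous w n := by
  refine (weightedHomogeneousSubmodule 𝕜 w n).sum_mem fun s _ => ?_
  by_cases hs : a s = 0
  · rw [hs, C_0, zero_mul]
    exact Submodule.zero_mem _
  · rw [← smul_eq_C_mul, ← h s hs]
    exact Submodule.smul_mem _ _ (isWeightedHomogeneous_X 𝕜 w s)

/-- The derivative in direction `conj a`. -/
def dirDeriv {𝕜 σ : Type*} [RCLike 𝕜] [Fintype σ] (a : σ → 𝕜) (g : MvPolynomial σ 𝕜) :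
    MvPolynomial σ 𝕜 :=
  ∑ s, C (starRingEnd 𝕜 (a s)) * pderiv s g

lemma fischer_linForm_mul (a : σ → 𝕜) (f g : MvPolynomial σ 𝕜) :
    fischer (linForm a * f) g = fischer f (dirDeriv a g) := by
  rw [linForm, Finset.sum_mul, fischer_sum_left, dirDeriv, fischer_sum_right]
  refine Finset.sum_congr rfl fun s _ => ?_
  rw [mul_assoc, ← smul_eq_C_mul, fischer_smul_left, fischer_X_mul_left, ← smul_eq_C_mul,
    fischer_smul_right]

/-- This is Euler's identity for the weight `w`, evaluated at `v`. -/
lemma aeval_dirDeriv {a v : σ → 𝕜} {w : σ → ℕ} (hav : ∀ s, starRingEnd 𝕜 (a s) = w s * v s)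
    {g : MvPolynomial σ 𝕜} {n : ℕ} (hg : g.IsWeightedHomogeneous w n) :
    aeval v (dirDeriv a g) = n * aeval v g := by
  have h := congrArg (aeval v) hg.sum_weight_X_mul_pderiv
  simp only [map_sum, nsmul_eq_mul, map_mul, aeval_X, map_natCast] at h
  rw [← h, dirDeriv, map_sum]
  refine Finset.sum_congr rfl fun s _ => ?_
  rw [map_mul, aeval_C, hav]
  simp [mul_assoc]

lemma isWeightedHomogeneous_dirDeriv {a : σ → 𝕜} {w : σ → ℕ} {g : MvPolynomial σ 𝕜} {n n' : ℕ}
    (hg : g.IsWeightedHomogeneous w n) (h : ∀ s, a s ≠ 0 → n' + w s = n) :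
    (dirDeriv a g).IsWeightedHomogeneous w n' := by
  refine (weightedHomogeneousSubmodule 𝕜 w n').sum_mem fun s _ => ?_
  by_cases hs : a s = 0
  · rw [hs, map_zero, C_0, zero_mul]
    exact Submodule.zero_mem _
  · rw [← smul_eq_C_mul]
    exact Submodule.smul_mem _ _ (hg.pderiv (h s hs))

lemma fischer_one_left {g : MvPolynomial σ 𝕜} (hg : g.IsHomogeneous 0) (v : σ → 𝕜) :
    fischer 1 g = aeval v g := by
  rw [← totalDegree_zero_iff_isHomogeneous, totalDegree_eq_zero_iff_eq_C] at hg
  have h1 : (1 : MvPolynomial σ 𝕜) = monomial 0 1 := rfl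
  rw [h1, fischer_monomial_left]
  conv_rhs => rw [hg]
  simp

variable {τ : σ → σ}

lemma lap_linForm_mul (hτ : Function.Involutive τ) (a : σ → 𝕜) (f : MvPolynomial σ 𝕜) :
    lap 𝕜 τ (linForm a * f) =
      2 * ∑ s, C (a s) * pderiv (τ s) f + linForm a * lap 𝕜 τ f := by
  rw [linForm, Finset.sum_mul, map_sum, Finset.mul_sum, Finset.sum_mul, ← Finset.sum_add_distrib]
  refine Finset.sum_congr rfl fun s _ => ?_
  rw [mul_assoc, ← smul_eq_C_mul, map_smul, lap_X_mul hτ]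
  simp only [smul_eq_C_mul]
  ring

/-- A sum `∑ q_j B^j g_j` with `Δ g_j = d_j g_{j+1}` is harmonic if the coefficients satisfy the
corresponding recursion. -/
lemma lap_sum_quad_pow (hτ : Function.Involutive τ) {g : ℕ → MvPolynomial σ 𝕜} {n : ℕ → ℕ}
    {q d : ℕ → 𝕜} {J : ℕ} (hg : ∀ j ≤ J, (g j).IsHomogeneous (n j))
    (hd : ∀ j ≤ J, lap 𝕜 τ (g j) = d j • g (j + 1))
    (hq : ∀ j < J, q (j + 1) * (((j + 1) * (2 * Fintype.card σ + 4 * n (j + 1) + 4 * j) : ℕ) : 𝕜) +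
      q j * d j = 0) :
    lap 𝕜 τ (∑ j ∈ Finset.range (J + 1), q j • (quad 𝕜 τ ^ j * g j)) =
      (q J * d J) • (quad 𝕜 τ ^ J * g (J + 1)) := by
  induction J with
  | zero => simp [hd 0 le_rfl, smul_smul]
  | succ J ih =>
    rw [Finset.sum_range_succ, map_add, ih (fun j hj => hg j (by omega))
      (fun j hj => hd j (by omega)) (fun j hj => hq j (by omega)), map_smul,
      lap_quad_pow_mul hτ (hg (J + 1) le_rfl), hd (J + 1) le_rfl, mul_smul_comm, smul_add,
      smul_smul, smul_smul, ← add_assoc, ← add_smul, add_comm (q J * d J), hq J (by omega),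
      zero_smul, zero_add]

/-- Terms with `j ≥ 1` carry a factor `B`, whose adjoint `Δ` kills `h`. -/
lemma fischer_sum_quad_pow {g : ℕ → MvPolynomial σ 𝕜} {q : ℕ → 𝕜} {J : ℕ} {h : MvPolynomial σ 𝕜}
    (hh : lap 𝕜 τ h = 0) :
    fischer (∑ j ∈ Finset.range (J + 1), q j • (quad 𝕜 τ ^ j * g j)) h =
      starRingEnd 𝕜 (q 0) * fischer (g 0) h := by
  rw [Finset.sum_range_succ', fischer_add_left, fischer_sum_left, Finset.sum_eq_zero, zero_add,
    fischer_smul_left, pow_zero, one_mul]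
  intro j _
  rw [fischer_smul_left, pow_succ', mul_assoc, fischer_quad_mul_left, hh, fischer_zero_right,
    mul_zero]

lemma lap_pderiv (s : σ) (f : MvPolynomial σ 𝕜) :
    lap 𝕜 τ (pderiv s f) = pderiv s (lap 𝕜 τ f) := by
  rw [lap_apply, lap_apply, map_sum]
  refine Finset.sum_congr rfl fun t _ => ?_
  rw [pderiv_comm (τ t) s, pderiv_comm t s]

/-- The Laplacians of `X_s h` and of `B ∂_{τ s} h` are both multiples of `∂_{τ s} h`, and the second
factor is nonzero. On the sphere this splits `X_s h` into a harmonic of degree `n + 1` and a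
multiple of the harmonic `∂_{τ s} h`. -/
lemma exists_lap_X_mul_sub [Nonempty σ] (hτ : Function.Involutive τ) (s : σ)
    {h : MvPolynomial σ 𝕜} {n : ℕ} (hh : h ∈ harmonics 𝕜 τ n) :
    ∃ c : 𝕜, lap 𝕜 τ (X s * h - c • (quad 𝕜 τ * pderiv (τ s) h)) = 0 := by
  have hp : (pderiv (τ s) h).IsHomogeneous (n - 1) := IsHomogeneous.pderiv hh.1
  have h0 : lap 𝕜 τ h = 0 := hh.2
  have hpos : 0 < 2 * Fintype.card σ + 4 * (n - 1) := by
    have := Fintype.card_pos (α := σ)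
    omega
  have hne : ((2 * Fintype.card σ + 4 * (n - 1) : ℕ) : 𝕜) ≠ 0 := Nat.cast_ne_zero.2 hpos.ne'
  refine ⟨2 / ((2 * Fintype.card σ + 4 * (n - 1) : ℕ) : 𝕜), ?_⟩
  rw [map_sub, map_smul, lap_X_mul hτ, lap_quad_mul hτ hp, lap_pderiv, h0, map_zero, mul_zero,
    mul_zero, add_zero, add_zero, smul_smul, div_mul_cancel₀ _ hne, smul_eq_C_mul, map_ofNat,
    sub_self]

end Reproducing

/-! ### Vanishing on a sphere, multiplication by monomials, spans of kernels -/

section Evaluation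

variable {𝕜 σ E ι : Type*} [RCLike 𝕜]

lemma aeval_scale_of_isWeightedHomogeneous [Fintype σ] {w : σ → ℕ} {n : ℕ} {g : MvPolynomial σ 𝕜}
    (hg : g.IsWeightedHomogeneous w n) (c : 𝕜) (v : σ → 𝕜) :
    aeval (fun s => c ^ w s * v s) g = c ^ n * aeval v g := by
  rw [aeval_def, aeval_def, eval₂_eq', eval₂_eq', Finset.mul_sum]
  refine Finset.sum_congr rfl fun α hα => ?_
  have h : ∏ s, (c ^ w s) ^ α s = c ^ n := by
    rw [← hg (mem_support_iff.1 hα), Finsupp.weight_apply, Finsupp.sum_fintype _ _ (by simp),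
      ← Finset.prod_pow_eq_pow_sum]
    exact Finset.prod_congr rfl fun s _ => by rw [← pow_mul, smul_eq_mul, mul_comm]
  simp only [mul_pow, Finset.prod_mul_distrib, h]
  ring

/-- A homogeneous polynomial that vanishes on the sphere is zero, if every nonzero vector of the
real form defined by `τ` is a multiple of a vector of the sphere. -/
lemma eq_zero_of_restrict_eq_zero [Fintype σ] [Nonempty σ] {τ : σ → σ}
    (hτ : Function.Involutive τ) {e : E → σ → 𝕜} {V : Set (σ → 𝕜)}
    (hdense : ∀ f : MvPolynomial σ 𝕜, (∀ v ∈ V, aeval v f = 0) → f = 0)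
    (hscale : ∀ v ∈ V, v ≠ 0 → ∃ (x : E) (c : 𝕜), v = fun s => c * e x s)
    {n : ℕ} {f : MvPolynomial σ 𝕜} (hf : f.IsHomogeneous n) (h0 : restrict e f = 0) : f = 0 := by
  -- The origin is the one vector of `V` that scaling from the sphere need not reach; there the
  -- factor `B` vanishes.
  have h : quad 𝕜 τ * f = 0 := by
    refine hdense _ fun v hv => ?_
    by_cases hv0 : v = 0
    · rw [hv0, map_mul]
      simp [quad]
    · obtain ⟨x, c, rfl⟩ := hscale v hv hv0
      have h1 := aeval_scale_of_isWeightedHomogeneous hf c (e x)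
      simp only [Pi.one_apply, pow_one] at h1
      rw [map_mul, h1, ← restrict_apply e, h0]
      simp
  exact (mul_eq_zero.1 h).resolve_left (quad_ne_zero hτ)

lemma mem_of_forall_mem_of_iSup {V W : Type*} [AddCommGroup V] [Module 𝕜 V] [AddCommGroup W]
    [Module 𝕜 W] {H : ι → Submodule 𝕜 V} {S : Set ι} (T : V →ₗ[𝕜] W) {N : Submodule 𝕜 W}
    (h : ∀ m ∈ S, ∀ f ∈ H m, T f ∈ N) {f : V} (hf : f ∈ ⨆ m ∈ S, H m) : T f ∈ N :=
  (iSup₂_le fun m hm f hf => h m hm f hf : ⨆ m ∈ S, H m ≤ N.comap T) hf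

lemma mem_biSup_of_subset {V : Type*} [AddCommGroup V] [Module 𝕜 V] {H : ι → Submodule 𝕜 V}
    {S T : Set ι} (h : S ⊆ T) {f : V} (hf : f ∈ ⨆ m ∈ S, H m) : f ∈ ⨆ m ∈ T, H m :=
  (biSup_mono fun _ hi => h hi : ⨆ m ∈ S, H m ≤ ⨆ m ∈ T, H m) hf

/-- If multiplication by coordinates is compatible with the family `S`, then so is multiplication
by monomials. -/
lemma restrict_monomial_mul_mem {e : E → σ → 𝕜} {H : ι → Submodule 𝕜 (E → 𝕜)}
    {S : (σ →₀ ℕ) → Set ι} {f : E → 𝕜} (h0 : f ∈ ⨆ m ∈ S 0, H m)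
    (hstep : ∀ α s, ∀ m ∈ S α, ∀ g ∈ H m,
      restrict e (X s) * g ∈ ⨆ n ∈ S (α + Finsupp.single s 1), H n) (α : σ →₀ ℕ) :
    restrict e (monomial α 1) * f ∈ ⨆ m ∈ S α, H m := by
  have hk : ∀ k, ∀ α : σ →₀ ℕ, α.degree = k →
      restrict e (monomial α 1) * f ∈ ⨆ m ∈ S α, H m := by
    intro k
    induction k with
    | zero =>
      intro α hα
      rw [Finsupp.degree_eq_zero_iff] at hα
      subst hα
      have : restrict e (monomial 0 1) = 1 := by
        ext x
        simp [restrict_apply]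
      rwa [this, one_mul]
    | succ k ih =>
      intro α hα
      have hα0 : α ≠ 0 := by
        rintro rfl
        simp at hα
      obtain ⟨s, hs⟩ := Finsupp.ne_iff.1 hα0
      have hαs : α - Finsupp.single s 1 + Finsupp.single s 1 = α :=
        Finsupp.sub_add_single_one_cancel hs
      have hdeg : (α - Finsupp.single s 1).degree = k := by
        have := congrArg Finsupp.degree hαs
        rw [map_add, Finsupp.degree_single, hα] at this
        omega
      have h1 : restrict e (monomial α 1) * f =
          restrict e (X s) * (restrict e (monomial (α - Finsupp.single s 1) 1) * f) := by
        rw [← mul_assoc, ← restrict_mul, X, monomial_mul, one_mul, add_comm, hαs]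
      rw [h1]
      refine mem_of_forall_mem_of_iSup (LinearMap.mulLeft 𝕜 (restrict e (X s)))
        (fun m hm g hg => ?_) (ih _ hdeg)
      have := hstep (α - Finsupp.single s 1) s m hm g hg
      rwa [hαs] at this
  exact hk _ α rfl

lemma restrict_mul_mem {e : E → σ → 𝕜} {H : ι → Submodule 𝕜 (E → 𝕜)} {S : (σ →₀ ℕ) → Set ι}
    {T : Set ι} {f : E → 𝕜} (h0 : f ∈ ⨆ m ∈ S 0, H m)
    (hstep : ∀ α s, ∀ m ∈ S α, ∀ g ∈ H m,
      restrict e (X s) * g ∈ ⨆ n ∈ S (α + Finsupp.single s 1), H n)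
    {q : MvPolynomial σ 𝕜} (hq : ∀ α ∈ q.support, S α ⊆ T) :
    restrict e q * f ∈ ⨆ m ∈ T, H m := by
  rw [q.as_sum, map_sum, Finset.sum_mul]
  refine Submodule.sum_mem _ fun α hα => ?_
  have h1 : monomial α (coeff α q) = coeff α q • monomial α (1 : 𝕜) := by
    rw [smul_monomial, smul_eq_mul, mul_one]
  rw [h1, map_smul, smul_mul_assoc]
  exact Submodule.smul_mem _ _ (mem_biSup_of_subset (hq α hα)
    (restrict_monomial_mul_mem h0 hstep α))

open scoped Pointwise in
/-- Products of combinations of monomials lie in the span of `K` when the monomials do. -/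
lemma mul_mem_span_of_monomials {A M : Type*} [CommRing A] [Algebra ℝ A] [AddCommMonoid M]
    {K : ι → A} {p : M → A} (hadd : ∀ a b, p (a + b) = p a * p b)
    (hK : ∀ i, K i ∈ Submodule.span ℝ (Set.range p))
    (hp : ∀ a, p a ∈ Submodule.span ℝ (Set.range K)) (i j : ι) :
    K i * K j ∈ Submodule.span ℝ (Set.range K) := by
  have h1 := Submodule.mul_mem_mul (hK i) (hK j)
  rw [Submodule.span_mul_span] at h1
  refine (Submodule.span_le.2 ?_ : Submodule.span ℝ (Set.range p * Set.range p) ≤ _) h1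
  rintro _ ⟨_, ⟨a, rfl⟩, _, ⟨b, rfl⟩, rfl⟩
  change p a * p b ∈ _
  rw [← hadd]
  exact hp _

end Evaluation

/-! ### The real sphere -/

section Real

/-- The coordinates of a point of the real sphere. -/
def realCoord (d : ℕ) (x : UnitSphere ℝ d) (i : Fin d) : ℝ := x.1 i

lemma involutive_id {α : Type*} : Function.Involutive (id : α → α) := fun _ => rfl

lemma inner_eq_sum_realCoord {d : ℕ} (x y : UnitSphere ℝ d) :
    inner ℝ x.1 y.1 = ∑ i, realCoord d y i * realCoord d x i := by
  simp [PiLp.inner_apply, realCoord]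

lemma sum_realCoord_sq {d : ℕ} (x : UnitSphere ℝ d) :
    ∑ i, realCoord d x i * realCoord d x i = 1 := by
  rw [← inner_eq_sum_realCoord, real_inner_self_eq_norm_sq, norm_eq_of_mem_sphere, one_pow]

lemma aeval_realCoord_quad {d : ℕ} (x : UnitSphere ℝ d) :
    aeval (realCoord d x) (quad ℝ (id : Fin d → Fin d)) = 1 := by
  simpa [quad] using sum_realCoord_sq x

lemma eq_zero_of_restrict_realCoord {d : ℕ} [Nonempty (Fin d)] (n : ℕ)
    (f : MvPolynomial (Fin d) ℝ) (hf : f.IsHomogeneous n) (h0 : restrict (realCoord d) f = 0) :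
    f = 0 := by
  refine eq_zero_of_restrict_eq_zero (τ := id) (V := Set.univ) involutive_id (fun f hf => ?_)
    (fun v _ hv => ?_) hf h0
  · refine MvPolynomial.funext fun v => ?_
    simpa [aeval_eq_eval] using hf v trivial
  · have hv' : WithLp.toLp 2 v ≠ (0 : EuclideanSpace ℝ (Fin d)) := fun h =>
      hv (by simpa using congrArg WithLp.ofLp h)
    have hn := norm_ne_zero_iff.2 hv'
    refine ⟨⟨‖WithLp.toLp 2 v‖⁻¹ • WithLp.toLp 2 v, ?_⟩, ‖WithLp.toLp 2 v‖, ?_⟩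
    · rw [mem_sphere_zero_iff_norm, norm_smul, norm_inv, norm_norm, inv_mul_cancel₀ hn]
    · ext i
      simp only [realCoord, PiLp.smul_apply, smul_eq_mul]
      rw [mul_inv_cancel_left₀ hn]

/-- Composition with the antipodal map. -/
def antipodal (d : ℕ) : Module.End ℝ (UnitSphere ℝ d → ℝ) := LinearMap.funLeft ℝ ℝ fun x => -x

lemma restrict_mem_eigenspace_antipodal {d n : ℕ} {f : MvPolynomial (Fin d) ℝ}
    (hf : f.IsHomogeneous n) :
    restrict (realCoord d) f ∈ (antipodal d).eigenspace ((-1) ^ n) := by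
  rw [Module.End.mem_eigenspace_iff]
  ext x
  have h := aeval_scale_of_isWeightedHomogeneous hf (-1) (realCoord d x)
  simp only [Pi.one_apply, pow_one, neg_one_mul] at h
  exact h

/-- The general criterion admits only components of the parity of `N`. The antipodal map acts by
`(-1)^n` on `Harm_n`, so components of the other parity can be discarded. -/
lemma quad_dvd_of_restrict_mem_realHarm {d : ℕ} [Nonempty (Fin d)] {N j m : ℕ}
    (hm : m + 2 * j = N) {P : MvPolynomial (Fin d) ℝ} (hP : P.IsHomogeneous N)
    (h : restrict (realCoord d) P ∈ ⨆ n ≠ m, realHarm d n) :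
    quad ℝ (id : Fin d → Fin d) ∣ (lap ℝ (id : Fin d → Fin d) ^ j) P := by
  refine quad_dvd_lap_iterate_of_restrict_mem involutive_id one_ne_zero aeval_realCoord_quad
    eq_zero_of_restrict_realCoord hP ?_
  have h1 := mem_iSup_of_mem_eigenspace (antipodal d) (realHarm d) (fun n => (-1) ^ n)
    (fun n => by
      rintro _ ⟨f, hf, rfl⟩
      exact restrict_mem_eigenspace_antipodal hf.1)
    (restrict_mem_eigenspace_antipodal hP) (s := {n | n ≠ m}) h
  refine mem_biSup_of_subset (fun t ht => ?_) h1
  obtain ⟨ht1, ht2⟩ := ht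
  refine ⟨?_, fun h => ht1 (by omega)⟩
  rcases Nat.even_or_odd t with h | h <;> rcases Nat.even_or_odd N with h' | h' <;>
    simp only [h.neg_one_pow, h'.neg_one_pow] at ht2 <;> norm_num at ht2
  · rw [Nat.even_iff.1 h, Nat.even_iff.1 h']
  · rw [Nat.odd_iff.1 h, Nat.odd_iff.1 h']

/-- Case `j = 0` of the criterion: a harmonic polynomial whose restriction lies in the other spaces
is divisible by `B`, hence zero. -/
lemma iSupIndep_realHarm {d : ℕ} [Nonempty (Fin d)] : iSupIndep (realHarm d) := by
  intro m
  rw [Submodule.disjoint_def]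
  rintro _ ⟨h, hh, rfl⟩ hf
  have h1 := quad_dvd_of_restrict_mem_realHarm (j := 0) (m := m) rfl hh.1 hf
  rw [pow_zero, Module.End.one_apply] at h1
  rw [eq_zero_of_lap_eq_zero_of_dvd _ hh.2 h1, map_zero]

lemma restrict_X_mul_mem_realHarm {d : ℕ} [Nonempty (Fin d)] (s : Fin d) {m : ℕ}
    {g : UnitSphere ℝ d → ℝ} (hg : g ∈ realHarm d m) :
    restrict (realCoord d) (X s) * g ∈ ⨆ n ∈ {n | n = m + 1 ∨ n + 1 = m}, realHarm d n := by
  obtain ⟨h, hh, rfl⟩ := hg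
  change restrict (realCoord d) (X s) * restrict (realCoord d) h ∈ _
  obtain ⟨c, hc⟩ := exists_lap_X_mul_sub involutive_id s hh
  have h1 : restrict (realCoord d) (X s) * restrict (realCoord d) h =
      restrict (realCoord d) (X s * h - c • (quad ℝ (id : Fin d → Fin d) * pderiv (id s) h)) +
        c • restrict (realCoord d) (pderiv s h) := by
    ext x
    simp only [map_sub, map_smul, restrict_mul, Pi.add_apply, Pi.sub_apply, Pi.mul_apply,
      Pi.smul_apply, restrict_apply, aeval_realCoord_quad, one_mul, id_eq, sub_add_cancel]
  have hh1 : h.IsHomogeneous m := hh.1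
  have hh2 : lap ℝ id h = 0 := hh.2
  -- For `m = 0` there is no lower degree; the derivatives of a constant vanish, so no lower term is
  -- needed.
  rcases m with _ | m
  · have h0 : ∀ t, pderiv t h = 0 := fun t => by
      rw [← totalDegree_zero_iff_isHomogeneous, totalDegree_eq_zero_iff_eq_C] at hh1
      rw [hh1, pderiv_C]
    simp only [h0, mul_zero, smul_zero, sub_zero, map_zero, add_zero] at h1 hc
    rw [h1]
    refine Submodule.mem_iSup_of_mem 1 (Submodule.mem_iSup_of_mem (Or.inl rfl) ?_)
    exact Submodule.mem_map_of_mem ⟨by simpa using (isHomogeneous_X ℝ s).mul hh1, hc⟩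
  · rw [h1]
    have hp : (pderiv s h).IsHomogeneous m := IsHomogeneous.pderiv hh1
    refine Submodule.add_mem _ ?_ (Submodule.smul_mem _ _ ?_)
    · refine Submodule.mem_iSup_of_mem (m + 1 + 1) (Submodule.mem_iSup_of_mem (Or.inl rfl) ?_)
      refine Submodule.mem_map_of_mem ⟨?_, hc⟩
      refine IsHomogeneous.sub ?_ ((homogeneousSubmodule (Fin d) ℝ _).smul_mem _ ?_)
      · rw [add_comm]
        exact (isHomogeneous_X ℝ s).mul hh1
      · have := (isHomogeneous_quad (𝕜 := ℝ) (id : Fin d → Fin d)).mul hp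
        rwa [show 2 + m = m + 1 + 1 by omega] at this
    · refine Submodule.mem_iSup_of_mem m (Submodule.mem_iSup_of_mem (Or.inr rfl) ?_)
      exact Submodule.mem_map_of_mem ⟨hp, (lap_pderiv (τ := id) s h).trans (by rw [hh2, map_zero])⟩

/-- Each of the `l` coordinate factors of a monomial of `g` moves the degree by `±1`; `J` counts the
downward moves. -/
lemma mul_mem_realHarm_aux {d : ℕ} [Nonempty (Fin d)] {k l : ℕ} {f g : UnitSphere ℝ d → ℝ}
    (hf : f ∈ realHarm d k) (hg : g ∈ realHarm d l) :
    g * f ∈ ⨆ n ∈ {m | ∃ J ≤ l, m + 2 * J = k + l}, realHarm d n := by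
  obtain ⟨q, hq, rfl⟩ := hg
  refine restrict_mul_mem (S := fun α => {m | ∃ J ≤ α.degree, m + 2 * J = k + α.degree}) ?_
    (fun α s m hm g hg => ?_) (fun α hα => ?_)
  · exact Submodule.mem_iSup_of_mem k (Submodule.mem_iSup_of_mem ⟨0, by simp⟩ hf)
  · refine mem_biSup_of_subset (fun n hn => ?_) (restrict_X_mul_mem_realHarm s hg)
    obtain ⟨J, hJ, hmJ⟩ := hm
    simp only [Set.mem_ofPred_eq, map_add, Finsupp.degree_single]
    rcases hn with rfl | hn
    · exact ⟨J, by omega, by omega⟩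
    · exact ⟨J + 1, by omega, by omega⟩
  · rw [show α.degree = l from (hq.1.degree_eq_sum_deg_support hα).symm]

lemma mul_mem_realHarm {d : ℕ} [Nonempty (Fin d)] (k l : ℕ) (f : UnitSphere ℝ d → ℝ)
    (hf : f ∈ realHarm d k) (g : UnitSphere ℝ d → ℝ) (hg : g ∈ realHarm d l) :
    f * g ∈ ⨆ n ∈ realIndexMul k l, realHarm d n := by
  -- Expanding the factor of smaller degree into monomials gives the bound `J ≤ min k l`.
  rcases le_total l k with h | h
  · rw [mul_comm]
    refine mem_biSup_of_subset (fun n hn => ?_) (mul_mem_realHarm_aux hf hg)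
    obtain ⟨J, hJ, hn⟩ := hn
    exact ⟨J, by omega, by omega⟩
  · refine mem_biSup_of_subset (fun n hn => ?_) (mul_mem_realHarm_aux hg hf)
    obtain ⟨J, hJ, hn⟩ := hn
    exact ⟨J, by omega, by omega⟩

/-! #### Gegenbauer polynomials as reproducing kernels -/

/-- The coefficient of `x^{k-2j}` in `Q_k`. -/
def realQCoeff (d k j : ℕ) : ℝ :=
  -- At `k = 0` the general formula would read `d/2 - 1`, because `k - 1` truncates.
  if k = 0 then 1 else
    (-1) ^ j * 2 ^ (k - 2 * j) * (ascPochhammer ℝ (k - 1 - j)).eval ((d : ℝ) / 2) *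
      ((d : ℝ) / 2 + k - 1) / ((j.factorial : ℝ) * ((k - 2 * j).factorial : ℝ))

lemma realQ_eq_sum (d k : ℕ) (x : ℝ) :
    realQ d k x = ∑ j ∈ Finset.range (k / 2 + 1), realQCoeff d k j * x ^ (k - 2 * j) := by
  rcases Nat.eq_zero_or_pos k with rfl | hk
  · simp [realQ, gegenbauerC, realQCoeff]
  -- The leading term is split off, so that the term `j + 1` of `C_k` meets the term `j` of
  -- `C_{k-2}`, with the same power of `x`.
  have h0 : gegenbauerC ((d : ℝ) / 2) k x =
      ∑ j ∈ Finset.range (k / 2), (-1) ^ (j + 1) *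
        (ascPochhammer ℝ (k - (j + 1))).eval ((d : ℝ) / 2) /
          (((j + 1).factorial : ℝ) * ((k - 2 * (j + 1)).factorial : ℝ)) *
            (2 * x) ^ (k - 2 * (j + 1)) + realQCoeff d k 0 * x ^ k := by
    rw [gegenbauerC, Finset.sum_range_succ']
    congr 1
    obtain ⟨k, rfl⟩ := Nat.exists_eq_succ_of_ne_zero hk.ne'
    simp only [realQCoeff, Nat.succ_ne_zero, if_false, Nat.sub_zero, mul_zero, Nat.succ_eq_add_one,
      Nat.add_sub_cancel, ascPochhammer_succ_eval, pow_zero, mul_pow]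
    push_cast
    ring
  have h2 : (if 2 ≤ k then gegenbauerC ((d : ℝ) / 2) (k - 2) x else 0) =
      ∑ j ∈ Finset.range (k / 2), (-1) ^ j *
        (ascPochhammer ℝ (k - 2 - j)).eval ((d : ℝ) / 2) /
          ((j.factorial : ℝ) * ((k - 2 - 2 * j).factorial : ℝ)) * (2 * x) ^ (k - 2 - 2 * j) := by
    split_ifs with h
    · rw [gegenbauerC, show (k - 2) / 2 + 1 = k / 2 by omega]
    · rw [show k / 2 = 0 by omega, Finset.sum_range_zero]
  rw [realQ, h0, h2, Finset.sum_range_succ', mul_zero, Nat.sub_zero, add_sub_right_comm,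
    ← Finset.sum_sub_distrib]
  congr 1
  refine Finset.sum_congr rfl fun j hj => ?_
  obtain ⟨r, rfl⟩ : ∃ r, k = 2 * (j + 1) + r :=
    Nat.exists_eq_add_of_le (by rw [Finset.mem_range] at hj; omega)
  rw [realQCoeff, if_neg (by omega), show 2 * (j + 1) + r - (j + 1) = j + r + 1 by omega,
    show 2 * (j + 1) + r - 2 * (j + 1) = r by omega, show 2 * (j + 1) + r - 2 - j = j + r by omega,
    show 2 * (j + 1) + r - 2 - 2 * j = r by omega,
    show 2 * (j + 1) + r - 1 - (j + 1) = j + r by omega, ascPochhammer_succ_eval,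
    Nat.factorial_succ]
  have hj0 : (j.factorial : ℝ) ≠ 0 := by positivity
  have hr0 : (r.factorial : ℝ) ≠ 0 := by positivity
  have hj1 : (j + 1 : ℝ) ≠ 0 := by positivity
  push_cast
  field_simp
  ring

lemma realQCoeff_zero_pos {d : ℕ} (hd : 1 ≤ d) (k : ℕ) : 0 < realQCoeff d k 0 := by
  rw [realQCoeff]
  split_ifs with hk
  · exact one_pos
  have hd' : (0 : ℝ) < d := by exact_mod_cast hd
  have hk' : (1 : ℝ) ≤ k := by exact_mod_cast Nat.one_le_iff_ne_zero.2 hk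
  have h1 : 0 < (ascPochhammer ℝ (k - 1 - 0)).eval ((d : ℝ) / 2) :=
    ascPochhammer_pos _ _ (by positivity)
  have h2 : 0 < (d : ℝ) / 2 + k - 1 := by linarith
  positivity

/-- The recursion required by `lap_sum_quad_pow`: it says that `∑ q_j B^j ⟨x,y⟩^{k-2j}` is harmonic.
-/
lemma realQCoeff_succ {d k j : ℕ} (hj : j < k / 2) :
    realQCoeff d k (j + 1) *
        (((j + 1) * (2 * Fintype.card (Fin d) + 4 * (k - 2 * (j + 1)) + 4 * j) : ℕ) : ℝ) +
      realQCoeff d k j * (((k - 2 * j) * (k - 2 * j - 1) : ℕ) : ℝ) = 0 := by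
  obtain ⟨r, rfl⟩ : ∃ r, k = 2 * (j + 1) + r := Nat.exists_eq_add_of_le (by omega)
  rw [realQCoeff, realQCoeff, if_neg (by omega), if_neg (by omega),
    show 2 * (j + 1) + r - 2 * (j + 1) = r by omega,
    show 2 * (j + 1) + r - 2 * j = r + 1 + 1 by omega,
    show 2 * (j + 1) + r - 1 - (j + 1) = j + r by omega,
    show 2 * (j + 1) + r - 1 - j = j + r + 1 by omega, ascPochhammer_succ_eval,
    Nat.factorial_succ, Nat.factorial_succ (r + 1), Nat.factorial_succ r, Fintype.card_fin]
  have hj0 : (j.factorial : ℝ) ≠ 0 := by positivity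
  have hr0 : (r.factorial : ℝ) ≠ 0 := by positivity
  have hj1 : (j + 1 : ℝ) ≠ 0 := by positivity
  have hr1 : (r + 1 : ℝ) ≠ 0 := by positivity
  have hr2 : (r + 1 + 1 : ℝ) ≠ 0 := by positivity
  simp only [Nat.add_sub_cancel]
  push_cast
  field_simp
  ring

lemma lap_linForm_pow_id {d : ℕ} {a : Fin d → ℝ} (ha : ∑ s, a s * a s = 1) (n : ℕ) :
    lap ℝ id (linForm a ^ n) = ((n * (n - 1) : ℕ) : ℝ) • linForm a ^ (n - 2) := by
  induction n with
  | zero => simp [lap_apply]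
  | succ n ih =>
    rw [pow_succ', lap_linForm_mul involutive_id, ih]
    have h1 : ∑ s, C (a s) * pderiv (id s) (linForm a ^ n) =
        (n : MvPolynomial (Fin d) ℝ) * linForm a ^ (n - 1) := by
      have h2 : ∀ s, C (a s) * pderiv (id s) (linForm a ^ n) =
          ((n : MvPolynomial (Fin d) ℝ) * linForm a ^ (n - 1)) * C (a s * a s) := fun s => by
        rw [pderiv_pow, id_eq, pderiv_linForm, C_mul]
        ring
      rw [Finset.sum_congr rfl fun s _ => h2 s, ← Finset.mul_sum, ← map_sum, ha, C_1, mul_one]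
    rw [h1]
    simp only [Nat.cast_smul_eq_nsmul, nsmul_eq_mul]
    rcases n with _ | _ | n
    · simp
    · simp
    · simp only [Nat.add_sub_cancel, show n + 1 + 1 + 1 - 2 = n + 1 by omega,
        show n + 1 + 1 - 2 = n by omega]
      push_cast
      ring

/-- The zonal harmonic of degree `k` with pole `y`. -/
def realZonal (d k : ℕ) (y : UnitSphere ℝ d) : MvPolynomial (Fin d) ℝ :=
  ∑ j ∈ Finset.range (k / 2 + 1), realQCoeff d k j •
    (quad ℝ id ^ j * linForm (realCoord d y) ^ (k - 2 * j))

lemma isHomogeneous_linForm_pow {d : ℕ} (a : Fin d → ℝ) (n : ℕ) :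
    (linForm a ^ n).IsHomogeneous n := by
  have h : (linForm a).IsHomogeneous 1 := isWeightedHomogeneous_linForm fun s _ => rfl
  simpa using h.pow n

lemma realZonal_mem (d k : ℕ) (y : UnitSphere ℝ d) : realZonal d k y ∈ harmonics ℝ id k := by
  constructor
  · refine Submodule.sum_mem _ fun j hj => Submodule.smul_mem _ _ ?_
    have := ((isHomogeneous_quad (𝕜 := ℝ) (id : Fin d → Fin d)).pow j).mul
      (isHomogeneous_linForm_pow (realCoord d y) (k - 2 * j))
    rw [Finset.mem_range] at hj
    rwa [show 2 * j + (k - 2 * j) = k by omega] at this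
  · change lap ℝ id (realZonal d k y) = 0
    rw [realZonal, lap_sum_quad_pow involutive_id
      (g := fun j => linForm (realCoord d y) ^ (k - 2 * j)) (n := fun j => k - 2 * j)
      (d := fun j => (((k - 2 * j) * (k - 2 * j - 1) : ℕ) : ℝ))
      (fun j _ => isHomogeneous_linForm_pow _ _)
      (fun j _ => by
        rw [lap_linForm_pow_id (sum_realCoord_sq y), Nat.sub_sub k (2 * j) 2]
        rfl)
      (fun j hj => realQCoeff_succ hj)]
    -- The sum telescopes to its last term, where the linear form has exponent `0` or `1` and hence
    -- zero Laplacian.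
    have : (k - 2 * (k / 2)) * (k - 2 * (k / 2) - 1) = 0 := by
      rw [show k - 2 * (k / 2) - 1 = 0 by omega, mul_zero]
    rw [this, Nat.cast_zero, mul_zero, zero_smul]

lemma aeval_realZonal {d : ℕ} (k : ℕ) (x y : UnitSphere ℝ d) :
    aeval (realCoord d x) (realZonal d k y) = realQ d k (inner ℝ x.1 y.1) := by
  rw [realQ_eq_sum, realZonal, map_sum]
  refine Finset.sum_congr rfl fun j _ => ?_
  rw [map_smul, map_mul, map_pow, map_pow, aeval_realCoord_quad, one_pow, one_mul, aeval_linForm,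
    ← inner_eq_sum_realCoord, smul_eq_mul]

/-- Each linear factor crosses to the other side as a derivative along `a`, and at the point `a`
Euler's identity turns it into the current degree. -/
lemma fischer_linForm_pow {d : ℕ} (a : Fin d → ℝ) (n : ℕ) {g : MvPolynomial (Fin d) ℝ}
    (hg : g.IsHomogeneous n) : fischer (linForm a ^ n) g = n.factorial * aeval a g := by
  induction n generalizing g with
  | zero => simpa using fischer_one_left hg a
  | succ n ih =>
    rw [pow_succ', fischer_linForm_mul,
      ih (isWeightedHomogeneous_dirDeriv (w := 1) hg fun s _ => rfl),
      aeval_dirDeriv (w := 1) (v := a) (fun s => by simp) hg, Nat.factorial_succ]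
    push_cast
    ring

instance finiteDimensional_harmonics {𝕜 σ : Type*} [RCLike 𝕜] [Fintype σ] (τ : σ → σ) (n : ℕ) :
    FiniteDimensional 𝕜 (harmonics 𝕜 τ n) := by
  have : FiniteDimensional 𝕜 (homogeneousSubmodule σ 𝕜 n) :=
    Module.Finite.iff_fg.2 (homogeneousSubmodule_fg σ 𝕜 n)
  exact Submodule.finiteDimensional_of_le inf_le_left

/-- The kernel `Q_k(⟨x,y⟩)`. -/
def realKernel (d k : ℕ) (x y : UnitSphere ℝ d) : ℝ := realQ d k (inner ℝ x.1 y.1)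

lemma isKernelOf_realKernel {d : ℕ} (hd : 1 ≤ d) (k : ℕ) :
    IsKernelOf (realHarm d k) (realKernel d k) := by
  have h := isKernelOf_of_reproducing (harmonics ℝ id k) (realCoord d) (realZonal d k)
    (realZonal_mem d k) (C := realQCoeff d k 0 * k.factorial)
    (mul_pos (realQCoeff_zero_pos hd k) (by positivity)) (fun y h hh => by
      rw [realZonal, fischer_sum_quad_pow (g := fun j => linForm (realCoord d y) ^ (k - 2 * j)) hh.2,
        mul_zero, Nat.sub_zero, fischer_linForm_pow _ _ hh.1]
      simp [mul_assoc])
  simp only [aeval_realZonal] at h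
  exact h

/-- `Q_k` has real coefficients and a nonzero leading one, so the `Q_k` and the powers of the inner
product have the same real span, which is closed under products. -/
lemma realKernel_mul_mem {d : ℕ} (hd : 1 ≤ d) (k l : ℕ) :
    realKernel d k * realKernel d l ∈ Submodule.span ℝ (Set.range (realKernel d)) := by
  let p : ℕ → UnitSphere ℝ d → UnitSphere ℝ d → ℝ := fun n x y => (inner ℝ x.1 y.1) ^ n
  have hK : ∀ k, realKernel d k =
      ∑ j ∈ Finset.range (k / 2 + 1), realQCoeff d k j • p (k - 2 * j) := fun k => by
    ext x y
    simp [realKernel, realQ_eq_sum, p]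
  refine mul_mem_span_of_monomials (p := p) (fun a b => ?_) (fun k => ?_) (fun n => ?_) k l
  · ext x y
    simp [p, pow_add]
  · rw [hK]
    exact Submodule.sum_mem _ fun j _ =>
      Submodule.smul_mem _ _ (Submodule.subset_span (Set.mem_range_self _))
  · induction n using Nat.strong_induction_on with
    | _ n ih =>
      have h1 := hK n
      rw [Finset.sum_range_succ', mul_zero, Nat.sub_zero] at h1
      have h2 : p n = (realQCoeff d n 0)⁻¹ • (realKernel d n -
          ∑ j ∈ Finset.range (n / 2), realQCoeff d n (j + 1) • p (n - 2 * (j + 1))) := by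
        rw [h1, add_sub_cancel_left, smul_smul, inv_mul_cancel₀ (realQCoeff_zero_pos hd n).ne',
          one_smul]
      rw [h2]
      refine Submodule.smul_mem _ _ (Submodule.sub_mem _
        (Submodule.subset_span (Set.mem_range_self _)) (Submodule.sum_mem _ fun j hj =>
          Submodule.smul_mem _ _ (ih _ ?_)))
      rw [Finset.mem_range] at hj
      omega

end Real

/-! #### Products of planar harmonics -/

section Planar

variable {d : ℕ}

/-- The pair `(Re (X_a + i X_b)^n, Im (X_a + i X_b)^n)`. -/
def planar (a b : Fin d) : ℕ → MvPolynomial (Fin d) ℝ × MvPolynomial (Fin d) ℝ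
  | 0 => (1, 0)
  | n + 1 => (X a * (planar a b n).1 - X b * (planar a b n).2,
      X b * (planar a b n).1 + X a * (planar a b n).2)

lemma isHomogeneous_planar (a b : Fin d) (n : ℕ) :
    (planar a b n).1.IsHomogeneous n ∧ (planar a b n).2.IsHomogeneous n := by
  induction n with
  | zero => exact ⟨isHomogeneous_one _ _, isHomogeneous_zero _ _ _⟩
  | succ n ih =>
    have h : ∀ (s : Fin d) {f : MvPolynomial (Fin d) ℝ}, f.IsHomogeneous n →
        (X s * f).IsHomogeneous (n + 1) := fun s f hf => by
      rw [add_comm]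
      exact (isHomogeneous_X ℝ s).mul hf
    exact ⟨(h a ih.1).sub (h b ih.2), (h b ih.1).add (h a ih.2)⟩

lemma pderiv_planar_of_ne {a b s : Fin d} (ha : s ≠ a) (hb : s ≠ b) (n : ℕ) :
    pderiv s (planar a b n).1 = 0 ∧ pderiv s (planar a b n).2 = 0 := by
  induction n with
  | zero => simp [planar]
  | succ n ih => simp [planar, pderiv_X_of_ne ha.symm, pderiv_X_of_ne hb.symm, ih]

/-- The Cauchy-Riemann equations for `(X_a + i X_b)^{n+1}`. -/
lemma pderiv_planar {a b : Fin d} (hab : a ≠ b) (n : ℕ) :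
    pderiv a (planar a b (n + 1)).1 = (n + 1 : MvPolynomial (Fin d) ℝ) * (planar a b n).1 ∧
    pderiv b (planar a b (n + 1)).1 = -((n + 1 : MvPolynomial (Fin d) ℝ) * (planar a b n).2) ∧
    pderiv a (planar a b (n + 1)).2 = (n + 1 : MvPolynomial (Fin d) ℝ) * (planar a b n).2 ∧
    pderiv b (planar a b (n + 1)).2 = (n + 1 : MvPolynomial (Fin d) ℝ) * (planar a b n).1 := by
  induction n with
  | zero => simp [planar, pderiv_X_of_ne hab, pderiv_X_of_ne hab.symm]
  | succ n ih =>
    obtain ⟨h1, h2, h3, h4⟩ := ih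
    rw [planar]
    simp only [map_sub, map_add, pderiv_mul, pderiv_X_self, pderiv_X_of_ne hab,
      pderiv_X_of_ne hab.symm, h1, h2, h3, h4]
    refine ⟨?_, ?_, ?_, ?_⟩ <;> (rw [planar]; push_cast; ring)

lemma lap_id_apply (f : MvPolynomial (Fin d) ℝ) : lap ℝ id f = ∑ s, pderiv s (pderiv s f) :=
  lap_apply id f

lemma lap_id_eq_add {a b : Fin d} (hab : a ≠ b) {f : MvPolynomial (Fin d) ℝ}
    (hf : ∀ s, s ≠ a → s ≠ b → pderiv s f = 0) :
    lap ℝ id f = pderiv a (pderiv a f) + pderiv b (pderiv b f) := by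
  classical
  rw [lap_id_apply, ← Finset.sum_pair hab (f := fun s => pderiv s (pderiv s f))]
  refine (Finset.sum_subset (Finset.subset_univ _) fun s _ hs => ?_).symm
  simp only [Finset.mem_insert, Finset.mem_singleton, not_or] at hs
  rw [hf s hs.1 hs.2, map_zero]

lemma lap_planar {a b : Fin d} (hab : a ≠ b) (n : ℕ) :
    lap ℝ id (planar a b n).1 = 0 ∧ lap ℝ id (planar a b n).2 = 0 := by
  rw [lap_id_eq_add hab fun s ha hb => (pderiv_planar_of_ne ha hb n).1,
    lap_id_eq_add hab fun s ha hb => (pderiv_planar_of_ne ha hb n).2]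
  have hc : ∀ (s : Fin d) (n : ℕ), pderiv s (n + 1 : MvPolynomial (Fin d) ℝ) = 0 := fun s n => by
    rw [← Nat.cast_succ, ← map_natCast C, pderiv_C]
  rcases n with _ | _ | n
  · simp [planar]
  · simp [planar, pderiv_X_of_ne hab, pderiv_X_of_ne hab.symm]
  · obtain ⟨h1, h2, h3, h4⟩ := pderiv_planar hab (n + 1)
    obtain ⟨k1, k2, k3, k4⟩ := pderiv_planar hab n
    simp only [h1, h2, h3, h4, map_neg, pderiv_mul, hc, k1, k2, k3, k4]
    constructor <;> ring

lemma planar_mem_harmonics {a b : Fin d} (hab : a ≠ b) (n : ℕ) :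
    (planar a b n).1 ∈ harmonics ℝ id n :=
  ⟨(isHomogeneous_planar a b n).1, (lap_planar hab n).1⟩

lemma lap_id_mul {f g : MvPolynomial (Fin d) ℝ} (hf : lap ℝ id f = 0) (hg : lap ℝ id g = 0) :
    lap ℝ id (f * g) = 2 * ∑ s, pderiv s f * pderiv s g := by
  have h : ∀ s, pderiv s (pderiv s (f * g)) =
      pderiv s (pderiv s f) * g + f * pderiv s (pderiv s g) + 2 * (pderiv s f * pderiv s g) :=
    fun s => by
      simp only [pderiv_mul, map_add]
      ring
  rw [lap_id_apply] at hf hg ⊢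
  rw [Finset.sum_congr rfl fun s _ => h s, Finset.sum_add_distrib, Finset.sum_add_distrib,
    ← Finset.sum_mul, ← Finset.mul_sum, ← Finset.mul_sum, hf, hg]
  ring

lemma sum_pderiv_mul_pderiv {a b : Fin d} (hab : a ≠ b) {f g : MvPolynomial (Fin d) ℝ}
    (hf : ∀ s, s ≠ a → s ≠ b → pderiv s f = 0) :
    ∑ s, pderiv s f * pderiv s g = pderiv a f * pderiv a g + pderiv b f * pderiv b g := by
  classical
  rw [← Finset.sum_pair hab (f := fun s => pderiv s f * pderiv s g)]
  refine (Finset.sum_subset (Finset.subset_univ _) fun s _ hs => ?_).symm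
  simp only [Finset.mem_insert, Finset.mem_singleton, not_or] at hs
  rw [hf s hs.1 hs.2, zero_mul]

/-- `Re ((X_a + i X_b)^k (X_a - i X_b)^l)`. -/
def planarProd (a b : Fin d) (k l : ℕ) : MvPolynomial (Fin d) ℝ :=
  (planar a b k).1 * (planar a b l).1 + (planar a b k).2 * (planar a b l).2

/-- The factors are harmonic, so only twice the product of gradients remains, and for the real and
the imaginary parts alike this is a multiple of `planarProd a b k l`. After one Laplacian all
further ones stay in that family, with positive constants. -/
lemma lap_planar_mul {a b : Fin d} (hab : a ≠ b) (k l : ℕ) :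
    lap ℝ id ((planar a b (k + 1)).1 * (planar a b (l + 1)).1) =
      ((2 * (k + 1) * (l + 1) : ℕ) : ℝ) • planarProd a b k l ∧
    lap ℝ id ((planar a b (k + 1)).2 * (planar a b (l + 1)).2) =
      ((2 * (k + 1) * (l + 1) : ℕ) : ℝ) • planarProd a b k l := by
  obtain ⟨h1, h2, h3, h4⟩ := pderiv_planar hab k
  obtain ⟨k1, k2, k3, k4⟩ := pderiv_planar hab l
  simp only [Nat.cast_smul_eq_nsmul, nsmul_eq_mul, planarProd]
  push_cast
  constructor
  · rw [lap_id_mul (lap_planar hab _).1 (lap_planar hab _).1, sum_pderiv_mul_pderiv hab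
      fun s ha hb => (pderiv_planar_of_ne ha hb _).1, h1, h2, k1, k2]
    ring
  · rw [lap_id_mul (lap_planar hab _).2 (lap_planar hab _).2, sum_pderiv_mul_pderiv hab
      fun s ha hb => (pderiv_planar_of_ne ha hb _).2, h3, h4, k3, k4]
    ring

lemma lap_planarProd {a b : Fin d} (hab : a ≠ b) (k l : ℕ) :
    lap ℝ id (planarProd a b (k + 1) (l + 1)) =
      ((4 * (k + 1) * (l + 1) : ℕ) : ℝ) • planarProd a b k l := by
  conv_lhs => rw [planarProd]
  rw [map_add, (lap_planar_mul hab k l).1, (lap_planar_mul hab k l).2, ← add_smul]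
  congr 1
  push_cast
  ring

lemma aeval_planar {a b : Fin d} {v : Fin d → ℂ} (ha : v a = 1) (hb : v b = 0) (n : ℕ) :
    aeval v (planar a b n).1 = 1 ∧ aeval v (planar a b n).2 = 0 := by
  induction n with
  | zero => simp [planar]
  | succ n ih => simp [planar, ha, hb, ih]

lemma aeval_lap_iterate_planarProd_ne_zero {a b : Fin d} (hab : a ≠ b) {v : Fin d → ℂ}
    (ha : v a = 1) (hb : v b = 0) {j k l : ℕ} (hk : j ≤ k) (hl : j ≤ l) :
    aeval v ((lap ℝ id ^ j) (planarProd a b k l)) ≠ 0 := by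
  induction j generalizing k l with
  | zero => simp [planarProd, aeval_planar ha hb]
  | succ j ih =>
    obtain ⟨k, rfl⟩ := Nat.exists_eq_add_of_le' (Nat.le_of_add_left_le hk)
    obtain ⟨l, rfl⟩ := Nat.exists_eq_add_of_le' (Nat.le_of_add_left_le hl)
    rw [pow_succ, Module.End.mul_apply, lap_planarProd hab, map_smul, map_smul]
    exact smul_ne_zero (by positivity) (ih (by omega) (by omega))

lemma aeval_lap_iterate_planar_mul_ne_zero {a b : Fin d} (hab : a ≠ b) {v : Fin d → ℂ}
    (ha : v a = 1) (hb : v b = 0) {j k l : ℕ} (hk : j ≤ k) (hl : j ≤ l) :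
    aeval v ((lap ℝ id ^ j) ((planar a b k).1 * (planar a b l).1)) ≠ 0 := by
  rcases j with _ | j
  · simp [aeval_planar ha hb]
  · obtain ⟨k, rfl⟩ := Nat.exists_eq_add_of_le' (Nat.le_of_add_left_le hk)
    obtain ⟨l, rfl⟩ := Nat.exists_eq_add_of_le' (Nat.le_of_add_left_le hl)
    rw [pow_succ, Module.End.mul_apply, (lap_planar_mul hab k l).1, map_smul, map_smul]
    exact smul_ne_zero (by positivity)
      (aeval_lap_iterate_planarProd_ne_zero hab ha hb (by omega) (by omega))

/-- With `ζ = X_a + i X_b`, the witnesses are `Re ζ^k` and `Re ζ^l`. If the component in `Harm_m`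
were missing, `B` would divide the `j`-th Laplacian of their product, which is nonzero at a zero of
`B`. -/
lemma exists_mul_notMem_realHarm (hd : 3 ≤ d) (k l m : ℕ) (hm : m ∈ realIndexMul k l) :
    ∃ f ∈ realHarm d k, ∃ g ∈ realHarm d l, f * g ∉ ⨆ n ≠ m, realHarm d n := by
  have : Nonempty (Fin d) := ⟨⟨0, by omega⟩⟩
  obtain ⟨j, hj, hm⟩ := hm
  let a : Fin d := ⟨0, by omega⟩
  let b : Fin d := ⟨1, by omega⟩
  let c : Fin d := ⟨2, by omega⟩
  have hab : a ≠ b := by simp [a, b]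
  have hac : a ≠ c := by simp [a, c]
  have hbc : b ≠ c := by simp [b, c]
  -- An isotropic vector, `1² + i² = 0`, whose first two coordinates are `(1, 0)`; the third
  -- coordinate is where `d ≥ 3` enters.
  let v : Fin d → ℂ := Pi.single a 1 + Pi.single c Complex.I
  have ha : v a = 1 := by simp [v, hac]
  have hb : v b = 0 := by simp [v, hab.symm, hbc]
  refine ⟨_, Submodule.mem_map_of_mem (planar_mem_harmonics hab k), _,
    Submodule.mem_map_of_mem (planar_mem_harmonics hab l), fun h => ?_⟩
  rw [show ∀ f g, realRestrict d f * realRestrict d g = restrict (realCoord d) (f * g) from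
    fun f g => (restrict_mul _ f g).symm] at h
  obtain ⟨R, hR⟩ := quad_dvd_of_restrict_mem_realHarm (j := j) (m := m) (N := k + l) (by omega)
    ((isHomogeneous_planar a b k).1.mul (isHomogeneous_planar a b l).1) h
  refine aeval_lap_iterate_planar_mul_ne_zero hab ha hb (hj.trans (min_le_left _ _))
    (hj.trans (min_le_right _ _)) ?_
  have hv : ∀ i, v i * v i = (if i = a then 1 else 0) + (if i = c then -1 else 0) := fun i => by
    by_cases h1 : i = a
    · rw [h1, ha]
      simp [hac]
    · by_cases h2 : i = c
      · simp [v, h2, hac.symm]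
      · simp [v, h1, h2]
  have hq : aeval v (quad ℝ (id : Fin d → Fin d)) = 0 := by
    simp [quad, hv, Finset.sum_add_distrib]
  rw [hR, map_mul, hq, zero_mul]

end Planar

lemma givesRealPotential_iff {d : ℕ} (F : ℝ → ℝ) (P : Submodule ℝ (UnitSphere ℝ d → ℝ)) :
    GivesRealPotential d F P ↔
      GivesPotential (realHarm d) (realKernel d) (fun x y => F (inner ℝ x.1 y.1)) P := by
  refine exists_congr fun f => and_congr_right fun _ => and_congr_left fun _ => ?_
  have h : ∀ x y : UnitSphere ℝ d, Finsupp.linearCombination ℝ (realKernel d) f x y =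
      f.sum fun k c => c * realQ d k (inner ℝ x.1 y.1) := fun x y => by
    simp [Finsupp.linearCombination_apply, Finsupp.sum, realKernel]
  refine ⟨fun hF => ?_, fun hF x y => ?_⟩
  · ext x y
    rw [hF, h]
  · rw [← h, ← hF]

theorem realPotential_mul {d : ℕ} (hd : 1 ≤ d) {F G : ℝ → ℝ} {U V : Set ℕ}
    (hF : GivesRealPotential d F (realSpace d U)) (hG : GivesRealPotential d G (realSpace d V)) :
    ∃ P : Submodule ℝ (UnitSphere ℝ d → ℝ), GivesRealPotential d (fun x => F x * G x) P ∧
      P ≤ realSpace d (realIndexProd U V) ∧ (3 ≤ d → P = realSpace d (realIndexProd U V)) := by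
  have : Nonempty (Fin d) := ⟨⟨0, hd⟩⟩
  simp only [givesRealPotential_iff] at hF hG ⊢
  obtain ⟨P, h1, h2, h3⟩ := GivesPotential.mul (isKernelOf_realKernel hd) iSupIndep_realHarm
    (realKernel_mul_mem hd) mul_mem_realHarm hF hG
  exact ⟨P, h1, h2, fun h => h3 (exists_mul_notMem_realHarm h)⟩

/-! ### The complex sphere -/

section Complex

variable {d : ℕ}

/-- The weight that counts the variables `z`. -/
def holWeight (d : ℕ) : Fin d ⊕ Fin d → ℕ := Sum.elim (fun _ => 1) (fun _ => 0)

/-- The weight that counts the variables `z̄`. -/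
def antiWeight (d : ℕ) : Fin d ⊕ Fin d → ℕ := Sum.elim (fun _ => 0) (fun _ => 1)

lemma holWeight_add_antiWeight (s : Fin d ⊕ Fin d) : holWeight d s + antiWeight d s = 1 := by
  rcases s with i | i <;> rfl

lemma holWeight_swap (s : Fin d ⊕ Fin d) : holWeight d s.swap = antiWeight d s := by
  rcases s with i | i <;> rfl

lemma antiWeight_swap (s : Fin d ⊕ Fin d) : antiWeight d s.swap = holWeight d s := by
  rcases s with i | i <;> rfl

lemma mem_bihomogeneous {p q : ℕ} {f : MvPolynomial (Fin d ⊕ Fin d) ℂ} :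
    f ∈ bihomogeneous d p q ↔
      f.IsWeightedHomogeneous (holWeight d) p ∧ f.IsWeightedHomogeneous (antiWeight d) q := Iff.rfl

lemma isHomogeneous_of_mem_bihomogeneous {p q : ℕ} {f : MvPolynomial (Fin d ⊕ Fin d) ℂ}
    (hf : f ∈ bihomogeneous d p q) : f.IsHomogeneous (p + q) := by
  intro α hα
  rw [← (mem_bihomogeneous.1 hf).1 hα, ← (mem_bihomogeneous.1 hf).2 hα]
  simp only [Finsupp.weight_apply, Finsupp.sum, ← Finset.sum_add_distrib, smul_eq_mul,
    ← mul_add, holWeight_add_antiWeight, Pi.one_apply]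

/-- The coordinates `(z, z̄)` of a point of the complex sphere. -/
def complexCoord (d : ℕ) (z : UnitSphere ℂ d) : Fin d ⊕ Fin d → ℂ :=
  Sum.elim (fun i => z.1 i) (fun i => (starRingEnd ℂ) (z.1 i))

lemma involutive_swap {α : Type*} : Function.Involutive (Sum.swap : α ⊕ α → α ⊕ α) :=
  Sum.swap_swap

/-- Each pair `z_i`, `z̄_i` is counted twice in the sum over all variables. For the same reason
`quad` takes the value `2` on the complex sphere. -/
lemma lap_swap (f : MvPolynomial (Fin d ⊕ Fin d) ℂ) :
    lap ℂ Sum.swap f = (2 : ℂ) • complexLaplacian d f := by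
  have h : complexLaplacian d f = ∑ i, pderiv (Sum.inl i) (pderiv (Sum.inr i) f) := by
    simp [complexLaplacian]
  have h' : ∑ i, pderiv (Sum.inr i) (pderiv (Sum.inl i) f) = complexLaplacian d f := by
    rw [h]
    exact Finset.sum_congr rfl fun i _ => pderiv_comm _ _ _
  rw [lap_apply, Fintype.sum_sum_type, two_smul]
  simp only [Sum.swap_inl, Sum.swap_inr]
  rw [h', ← h]

lemma lap_swap_eq_zero_iff {f : MvPolynomial (Fin d ⊕ Fin d) ℂ} :
    lap ℂ Sum.swap f = 0 ↔ complexLaplacian d f = 0 := by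
  rw [lap_swap, smul_eq_zero_iff_right two_ne_zero]

/-- Harmonic polynomials homogeneous of degree `p` in `z` and `q` in `z̄`. -/
def biharmonics (d : ℕ) (i : ℕ × ℕ) : Submodule ℂ (MvPolynomial (Fin d ⊕ Fin d) ℂ) :=
  bihomogeneous d i.1 i.2 ⊓ LinearMap.ker (lap ℂ Sum.swap)

/-- The spaces `H(p,q)`, indexed by pairs. -/
def complexHarmPair (d : ℕ) (i : ℕ × ℕ) : Submodule ℂ (UnitSphere ℂ d → ℂ) :=
  complexHarm d i.1 i.2

lemma complexHarmPair_eq (i : ℕ × ℕ) :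
    complexHarmPair d i = (biharmonics d i).map (restrict (complexCoord d)) := by
  have : LinearMap.ker (lap ℂ (Sum.swap : Fin d ⊕ Fin d → _)) =
      LinearMap.ker (complexLaplacian d) := by
    ext f
    exact lap_swap_eq_zero_iff
  rw [biharmonics, this]
  rfl

lemma biharmonics_le (i : ℕ × ℕ) : biharmonics d i ≤ harmonics ℂ Sum.swap (i.1 + i.2) :=
  fun _ hf => ⟨isHomogeneous_of_mem_bihomogeneous hf.1, hf.2⟩

lemma inner_eq_sum_complex (z w : UnitSphere ℂ d) :
    inner ℂ w.1 z.1 = ∑ i, starRingEnd ℂ (w.1 i) * z.1 i := by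
  simp [PiLp.inner_apply, mul_comm]

lemma sum_conj_mul_self (z : UnitSphere ℂ d) : ∑ i, starRingEnd ℂ (z.1 i) * z.1 i = 1 := by
  rw [← inner_eq_sum_complex, inner_self_eq_norm_sq_to_K, norm_eq_of_mem_sphere]
  simp

lemma aeval_complexCoord_quad (z : UnitSphere ℂ d) :
    aeval (complexCoord d z) (quad ℂ Sum.swap) = 2 := by
  have h := sum_conj_mul_self z
  have h' : ∑ i, z.1 i * starRingEnd ℂ (z.1 i) = 1 := by
    rw [← h]
    exact Finset.sum_congr rfl fun i _ => mul_comm _ _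
  rw [quad, map_sum, Fintype.sum_sum_type]
  simp only [map_mul, aeval_X, Sum.swap_inl, Sum.swap_inr, complexCoord, Sum.elim_inl,
    Sum.elim_inr, h, h']
  norm_num

/-- The vectors `(z, z̄)`. -/
def conjPairs (d : ℕ) : Set (Fin d ⊕ Fin d → ℂ) :=
  {v | ∀ i, v (Sum.inr i) = starRingEnd ℂ (v (Sum.inl i))}

/-- Under `z = x + i y`, `z̄ = x - i y` the polynomial becomes one that vanishes at all real `(x,
y)`, hence identically; the linear substitution is invertible over `ℂ`. -/
lemma eq_zero_of_forall_conjPairs (f : MvPolynomial (Fin d ⊕ Fin d) ℂ)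
    (hf : ∀ v ∈ conjPairs d, aeval v f = 0) : f = 0 := by
  let g : MvPolynomial (Fin d ⊕ Fin d) ℂ :=
    aeval (Sum.elim (fun i => X (Sum.inl i) + C Complex.I * X (Sum.inr i))
      (fun i => X (Sum.inl i) - C Complex.I * X (Sum.inr i))) f
  have hg : ∀ v : Fin d ⊕ Fin d → ℂ, aeval v g = aeval (Sum.elim
      (fun i => v (Sum.inl i) + Complex.I * v (Sum.inr i))
      (fun i => v (Sum.inl i) - Complex.I * v (Sum.inr i))) f := fun v => by
    change aeval v (aeval _ f) = _
    rw [comp_aeval_apply]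
    congr 2
    ext s
    rcases s with i | i <;> simp
  have hg0 : g = 0 := by
    refine MvPolynomial.funext_set (fun _ => Set.range ((↑) : ℝ → ℂ))
      (fun _ => Set.infinite_range_of_injective Complex.ofReal_injective) fun v hv => ?_
    rw [map_zero, ← aeval_eq_eval, hg]
    refine hf _ fun i => ?_
    obtain ⟨x, hx⟩ := hv (Sum.inl i) trivial
    obtain ⟨y, hy⟩ := hv (Sum.inr i) trivial
    simp [← hx, ← hy, sub_eq_add_neg]
  refine MvPolynomial.funext fun u => ?_
  -- The inverse substitution `x = (z + z̄)/2`, `y = -i (z - z̄)/2`, for independent complex `z` and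
  -- `z̄`.
  have h := hg (Sum.elim (fun i => (u (Sum.inl i) + u (Sum.inr i)) / 2)
    (fun i => -Complex.I * (u (Sum.inl i) - u (Sum.inr i)) / 2))
  rw [hg0, map_zero] at h
  rw [map_zero, ← aeval_eq_eval, h]
  congr 2
  ext s
  rcases s with i | i
  · simp only [Sum.elim_inl, Sum.elim_inr]
    linear_combination ((u (Sum.inl i) - u (Sum.inr i)) / 2) * Complex.I_sq
  · simp only [Sum.elim_inl, Sum.elim_inr]
    linear_combination (-(u (Sum.inl i) - u (Sum.inr i)) / 2) * Complex.I_sq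

lemma eq_zero_of_restrict_complexCoord [Nonempty (Fin d)] (n : ℕ)
    (f : MvPolynomial (Fin d ⊕ Fin d) ℂ) (hf : f.IsHomogeneous n)
    (h0 : restrict (complexCoord d) f = 0) : f = 0 := by
  refine eq_zero_of_restrict_eq_zero involutive_swap (V := conjPairs d)
    eq_zero_of_forall_conjPairs (fun v hvV hv => ?_) hf h0
  let z : EuclideanSpace ℂ (Fin d) := WithLp.toLp 2 fun i => v (Sum.inl i)
  have hz : z ≠ 0 := fun h => hv (by
    have h1 : ∀ i, v (Sum.inl i) = 0 := fun i => congrFun (congrArg WithLp.ofLp h) i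
    ext s
    rcases s with i | i
    · exact h1 i
    · rw [hvV i, h1 i, map_zero]
      rfl)
  have hn := norm_ne_zero_iff.2 hz
  have hn' : ((‖z‖ : ℝ) : ℂ) ≠ 0 := Complex.ofReal_ne_zero.2 hn
  refine ⟨⟨((‖z‖⁻¹ : ℝ) : ℂ) • z, ?_⟩, ((‖z‖ : ℝ) : ℂ), ?_⟩
  · rw [mem_sphere_zero_iff_norm, norm_smul, Complex.norm_real, norm_inv, norm_norm,
      inv_mul_cancel₀ hn]
  · ext s
    rcases s with i | i
    · simp only [complexCoord, Sum.elim_inl, PiLp.smul_apply, smul_eq_mul, Complex.ofReal_inv]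
      rw [mul_inv_cancel_left₀ hn']
    · simp only [complexCoord, Sum.elim_inr, PiLp.smul_apply, smul_eq_mul, map_mul,
        Complex.conj_ofReal, Complex.ofReal_inv, map_inv₀]
      rw [mul_inv_cancel_left₀ hn', hvV i]

/-! #### Rotation by a unit complex number of infinite order -/

/-- Scalar multiplication by `exp i` on the sphere. -/
def rotatePoint (z : UnitSphere ℂ d) : UnitSphere ℂ d :=
  ⟨Complex.exp Complex.I • z.1, by
    rw [mem_sphere_zero_iff_norm, norm_smul, norm_eq_of_mem_sphere, mul_one]
    simp [Complex.norm_exp]⟩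

/-- Composition with scalar multiplication by `exp i`. -/
def rotate (d : ℕ) : Module.End ℂ (UnitSphere ℂ d → ℂ) := LinearMap.funLeft ℂ ℂ rotatePoint

/-- The eigenvalue of `rotate` on `H(p,q)`. -/
def rotateEigenvalue (i : ℕ × ℕ) : ℂ :=
  Complex.exp Complex.I ^ i.1 * (starRingEnd ℂ) (Complex.exp Complex.I) ^ i.2

lemma rotateEigenvalue_eq (i : ℕ × ℕ) :
    rotateEigenvalue i = Complex.exp (((i.1 : ℂ) - i.2) * Complex.I) := by
  rw [rotateEigenvalue, ← Complex.exp_conj, Complex.conj_I, ← Complex.exp_nat_mul,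
    ← Complex.exp_nat_mul, ← Complex.exp_add]
  congr 1
  ring

/-- The eigenvalue is `exp(i(p - q))`. Two different values of `p - q` with the same exponential
would make a nonzero integer multiple of `2π` an integer, against the irrationality of `π`. -/
lemma add_eq_add_of_rotateEigenvalue_eq {i j : ℕ × ℕ}
    (h : rotateEigenvalue i = rotateEigenvalue j) : i.1 + j.2 = j.1 + i.2 := by
  rw [rotateEigenvalue_eq, rotateEigenvalue_eq, Complex.exp_eq_exp_iff_exists_int] at h
  obtain ⟨n, hn⟩ := h
  have h1 : ((i.1 : ℂ) - i.2) = (j.1 - j.2) + n * (2 * Real.pi) := by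
    refine mul_right_cancel₀ Complex.I_ne_zero ?_
    rw [hn]
    ring
  have h2 : ((i.1 : ℝ) - i.2) = (j.1 - j.2) + n * (2 * Real.pi) := by exact_mod_cast h1
  have hn0 : n = 0 := by
    by_contra hn0
    have h3 := (irrational_pi.intCast_mul (m := 2 * n) (by omega)).ne_int
      ((i.1 : ℤ) - i.2 - (j.1 - j.2))
    refine h3 ?_
    push_cast
    linarith
  rw [hn0] at h2
  have h4 : (i.1 : ℝ) + j.2 = j.1 + i.2 := by
    push_cast at h2
    linarith
  exact_mod_cast h4

lemma restrict_mem_eigenspace_rotate {i : ℕ × ℕ} {f : MvPolynomial (Fin d ⊕ Fin d) ℂ}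
    (hf : f ∈ bihomogeneous d i.1 i.2) :
    restrict (complexCoord d) f ∈ (rotate d).eigenspace (rotateEigenvalue i) := by
  rw [Module.End.mem_eigenspace_iff]
  ext z
  rw [mem_bihomogeneous] at hf
  rw [Pi.smul_apply, restrict_apply, rotateEigenvalue, smul_eq_mul, mul_assoc,
    ← aeval_scale_of_isWeightedHomogeneous hf.2, ← aeval_scale_of_isWeightedHomogeneous hf.1]
  change aeval (complexCoord d (rotatePoint z)) f = _
  congr 2
  ext s
  rcases s with i | i <;> simp [complexCoord, rotatePoint, holWeight, antiWeight]

/-- The general criterion sees only the total degree. Rotation leaves only bidegrees with the same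
`p - q` as `N`, and among these the total degree determines the bidegree. -/
lemma quad_dvd_of_restrict_mem_complexHarm [Nonempty (Fin d)] {N m : ℕ × ℕ} {j : ℕ}
    (hm1 : m.1 + j = N.1) (hm2 : m.2 + j = N.2) {P : MvPolynomial (Fin d ⊕ Fin d) ℂ}
    (hP : P ∈ bihomogeneous d N.1 N.2)
    (h : restrict (complexCoord d) P ∈ ⨆ n ≠ m, complexHarmPair d n) :
    quad ℂ Sum.swap ∣ (lap ℂ Sum.swap ^ j) P := by
  refine quad_dvd_lap_iterate_of_restrict_mem involutive_swap two_ne_zero aeval_complexCoord_quad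
    eq_zero_of_restrict_complexCoord (isHomogeneous_of_mem_bihomogeneous hP) ?_
  have h1 := mem_iSup_of_mem_eigenspace (rotate d) (complexHarmPair d) rotateEigenvalue
    (fun n => by
      rw [complexHarmPair_eq]
      rintro _ ⟨f, hf, rfl⟩
      exact restrict_mem_eigenspace_rotate hf.1)
    (restrict_mem_eigenspace_rotate hP) (s := {n | n ≠ m}) h
  have hle : ∀ n ∈ {n | n ∈ {n | n ≠ m} ∧ rotateEigenvalue n = rotateEigenvalue N},
      complexHarmPair d n ≤ ⨆ t ∈ {t | t % 2 = (N.1 + N.2) % 2 ∧ t + 2 * j ≠ N.1 + N.2},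
        (harmonics ℂ Sum.swap t).map (restrict (complexCoord d)) := ?_
  · exact iSup₂_le hle h1
  intro n hn
  have h2 := add_eq_add_of_rotateEigenvalue_eq hn.2
  have h3 : n ≠ m := hn.1
  rw [complexHarmPair_eq]
  refine le_iSup₂_of_le (n.1 + n.2) ⟨by omega, fun h => h3 ?_⟩ (Submodule.map_mono (biharmonics_le n))
  ext <;> omega

lemma iSupIndep_complexHarm [Nonempty (Fin d)] : iSupIndep (complexHarmPair d) := by
  intro m
  rw [Submodule.disjoint_def, complexHarmPair_eq]
  rintro _ ⟨h, hh, rfl⟩ hf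
  have h1 := quad_dvd_of_restrict_mem_complexHarm (j := 0) (m := m) rfl rfl hh.1 hf
  rw [pow_zero, Module.End.one_apply] at h1
  rw [eq_zero_of_lap_eq_zero_of_dvd _ hh.2 h1, map_zero]

/-! #### Products -/

lemma pderiv_eq_zero_of_isWeightedHomogeneous {σ : Type*} {w : σ → ℕ} {n : ℕ}
    {f : MvPolynomial σ ℂ} (hf : f.IsWeightedHomogeneous w n) {s : σ} (hs : n < w s) :
    pderiv s f = 0 := by
  ext α
  rw [coeff_pderiv, coeff_zero, hf.coeff_eq_zero, zero_mul]
  rw [map_add, Finsupp.weight_single]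
  simp
  omega

lemma isWeightedHomogeneous_quad_hol :
    (quad ℂ Sum.swap).IsWeightedHomogeneous (holWeight d) 1 := by
  refine (weightedHomogeneousSubmodule ℂ (holWeight d) 1).sum_mem fun s _ => ?_
  have := (isWeightedHomogeneous_X ℂ (holWeight d) s).mul
    (isWeightedHomogeneous_X ℂ (holWeight d) s.swap)
  rwa [holWeight_swap, holWeight_add_antiWeight] at this

lemma isWeightedHomogeneous_quad_anti :
    (quad ℂ Sum.swap).IsWeightedHomogeneous (antiWeight d) 1 := by
  refine (weightedHomogeneousSubmodule ℂ (antiWeight d) 1).sum_mem fun s _ => ?_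
  have := (isWeightedHomogeneous_X ℂ (antiWeight d) s).mul
    (isWeightedHomogeneous_X ℂ (antiWeight d) s.swap)
  rwa [antiWeight_swap, add_comm, holWeight_add_antiWeight] at this

/-- Multiplication by `z_i` raises `p` or lowers `q`, since the correction term is the derivative in
the conjugate variable; for `z̄_i` the roles are exchanged. -/
lemma restrict_X_mul_mem_complexHarm [Nonempty (Fin d)] (s : Fin d ⊕ Fin d) {m : ℕ × ℕ}
    {g : UnitSphere ℂ d → ℂ} (hg : g ∈ complexHarmPair d m) :
    restrict (complexCoord d) (X s) * g ∈
      ⨆ n ∈ {n : ℕ × ℕ | n = (m.1 + holWeight d s, m.2 + antiWeight d s) ∨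
        (n.1 + antiWeight d s = m.1 ∧ n.2 + holWeight d s = m.2)}, complexHarmPair d n := by
  rw [complexHarmPair_eq] at hg
  obtain ⟨h, hh, rfl⟩ := hg
  obtain ⟨c, hc⟩ := exists_lap_X_mul_sub involutive_swap s (biharmonics_le m hh)
  have h1 : restrict (complexCoord d) (X s) * restrict (complexCoord d) h =
      restrict (complexCoord d) (X s * h - c • (quad ℂ Sum.swap * pderiv s.swap h)) +
        (c * 2) • restrict (complexCoord d) (pderiv s.swap h) := by
    ext x
    simp only [map_sub, map_smul, restrict_mul, Pi.add_apply, Pi.sub_apply, Pi.mul_apply,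
      Pi.smul_apply, restrict_apply, aeval_complexCoord_quad, smul_eq_mul]
    ring
  have hhb := mem_bihomogeneous.1 hh.1
  have hh2 : lap ℂ Sum.swap h = 0 := hh.2
  have hX : X s * h ∈ bihomogeneous d (m.1 + holWeight d s) (m.2 + antiWeight d s) := by
    rw [mem_bihomogeneous, add_comm m.1, add_comm m.2]
    exact ⟨(isWeightedHomogeneous_X ℂ _ s).mul hhb.1, (isWeightedHomogeneous_X ℂ _ s).mul hhb.2⟩
  -- When the degree to be lowered is already `0`, the derivative vanishes and only the raised term
  -- remains.
  by_cases hs : antiWeight d s ≤ m.1 ∧ holWeight d s ≤ m.2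
  · have hp : pderiv s.swap h ∈
        bihomogeneous d (m.1 - antiWeight d s) (m.2 - holWeight d s) := by
      rw [mem_bihomogeneous]
      exact ⟨hhb.1.pderiv (by rw [holWeight_swap]; omega),
        hhb.2.pderiv (by rw [antiWeight_swap]; omega)⟩
    rw [h1]
    refine Submodule.add_mem _ ?_ (Submodule.smul_mem _ _ ?_)
    · refine Submodule.mem_iSup_of_mem _ (Submodule.mem_iSup_of_mem (Or.inl rfl) ?_)
      rw [complexHarmPair_eq]
      refine Submodule.mem_map_of_mem ⟨Submodule.sub_mem _ hX (Submodule.smul_mem _ _ ?_), hc⟩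
      have hq := mem_bihomogeneous.1 hp
      have ht := holWeight_add_antiWeight s
      have e1 := isWeightedHomogeneous_quad_hol.mul hq.1
      have e2 := isWeightedHomogeneous_quad_anti.mul hq.2
      rw [show 1 + (m.1 - antiWeight d s) = m.1 + holWeight d s by omega] at e1
      rw [show 1 + (m.2 - holWeight d s) = m.2 + antiWeight d s by omega] at e2
      exact mem_bihomogeneous.2 ⟨e1, e2⟩
    · refine Submodule.mem_iSup_of_mem (m.1 - antiWeight d s, m.2 - holWeight d s)
        (Submodule.mem_iSup_of_mem (Or.inr ⟨by simp; omega, by simp; omega⟩) ?_)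
      rw [complexHarmPair_eq]
      exact Submodule.mem_map_of_mem ⟨hp, (lap_pderiv s.swap h).trans (by rw [hh2, map_zero])⟩
  · have h0 : pderiv s.swap h = 0 := by
      rw [not_and_or, not_le, not_le] at hs
      rcases hs with hs | hs
      · exact pderiv_eq_zero_of_isWeightedHomogeneous hhb.1 (by rwa [holWeight_swap])
      · exact pderiv_eq_zero_of_isWeightedHomogeneous hhb.2 (by rwa [antiWeight_swap])
    simp only [h0, mul_zero, smul_zero, sub_zero, map_zero, add_zero] at h1 hc
    rw [h1]
    refine Submodule.mem_iSup_of_mem _ (Submodule.mem_iSup_of_mem (Or.inl rfl) ?_)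
    rw [complexHarmPair_eq]
    exact Submodule.mem_map_of_mem ⟨hX, hc⟩

lemma mul_mem_complexHarm_aux [Nonempty (Fin d)] {a b : ℕ × ℕ} {f g : UnitSphere ℂ d → ℂ}
    (hf : f ∈ complexHarmPair d a) (hg : g ∈ complexHarmPair d b) :
    g * f ∈ ⨆ n ∈ {m : ℕ × ℕ | ∃ J ≤ b.1 + b.2, m.1 + J = a.1 + b.1 ∧ m.2 + J = a.2 + b.2},
      complexHarmPair d n := by
  rw [complexHarmPair_eq] at hg
  obtain ⟨q, hq, rfl⟩ := hg
  refine restrict_mul_mem (S := fun α => {m : ℕ × ℕ |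
      ∃ J ≤ Finsupp.weight (holWeight d) α + Finsupp.weight (antiWeight d) α,
        m.1 + J = a.1 + Finsupp.weight (holWeight d) α ∧
        m.2 + J = a.2 + Finsupp.weight (antiWeight d) α}) ?_
    (fun α s m hm g hg => ?_) (fun α hα => ?_)
  · exact Submodule.mem_iSup_of_mem a (Submodule.mem_iSup_of_mem ⟨0, by simp⟩ hf)
  · refine mem_biSup_of_subset (fun n hn => ?_) (restrict_X_mul_mem_complexHarm s hg)
    obtain ⟨J, hJ, hJ1, hJ2⟩ := hm
    have ht := holWeight_add_antiWeight s
    simp only [Set.mem_ofPred_eq, map_add, Finsupp.weight_single, one_smul]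
    rcases hn with rfl | ⟨hn1, hn2⟩
    · exact ⟨J, by omega, by simp only; omega, by simp only; omega⟩
    · exact ⟨J + 1, by omega, by omega, by omega⟩
  · have hqb := mem_bihomogeneous.1 hq.1
    have hα' := mem_support_iff.1 hα
    simp only [hqb.1 hα', hqb.2 hα']
    exact subset_rfl

lemma mul_mem_complexHarm [Nonempty (Fin d)] (a b : ℕ × ℕ) (f : UnitSphere ℂ d → ℂ)
    (hf : f ∈ complexHarmPair d a) (g : UnitSphere ℂ d → ℂ) (hg : g ∈ complexHarmPair d b) :
    f * g ∈ ⨆ n ∈ complexIndexMul a b, complexHarmPair d n := by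
  -- For `a = (p,q)`, `b = (r,s)`, the sum `min p s + min q r` is the least of `p+q`, `p+r`, `q+s`,
  -- `r+s`. The smaller total degree bounds `J` by `p+q` and `r+s`; nonnegativity of the resulting
  -- bidegree bounds it by `p+r` and `q+s`.
  rcases le_total (b.1 + b.2) (a.1 + a.2) with h | h
  · rw [mul_comm]
    refine mem_biSup_of_subset (fun n hn => ?_) (mul_mem_complexHarm_aux hf hg)
    obtain ⟨J, hJ, hn1, hn2⟩ := hn
    exact ⟨J, by omega, by ext <;> simp only <;> omega⟩
  · refine mem_biSup_of_subset (fun n hn => ?_) (mul_mem_complexHarm_aux hg hf)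
    obtain ⟨J, hJ, hn1, hn2⟩ := hn
    exact ⟨J, by omega, by ext <;> simp only <;> omega⟩

end Complex

section Complex

variable {d : ℕ}

/-! #### The kernels of the spaces `H(p,q)` -/

/-- The coefficient of `z^{p-j} z̄^{q-j}` in `Q_{pq}`. -/
def complexQCoeff (d p q j : ℕ) : ℝ :=
  if p = 0 ∧ q = 0 then 1 else
    ((p + q + d - 1 : ℕ) : ℝ) / ((d - 1).factorial : ℝ) *
      ((-1) ^ j * ((d + p + q - j - 2).factorial : ℝ) /
        ((j.factorial : ℝ) * ((p - j).factorial : ℝ) * ((q - j).factorial : ℝ)))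

lemma complexQ_eq_sum (d p q : ℕ) (z : ℂ) :
    complexQ d p q z = ∑ j ∈ Finset.range (min p q + 1),
      (complexQCoeff d p q j : ℂ) * (z ^ (p - j) * starRingEnd ℂ z ^ (q - j)) := by
  rw [complexQ]
  split_ifs with h
  · obtain ⟨rfl, rfl⟩ := h
    simp [complexQCoeff]
  · rw [Finset.mul_sum]
    refine Finset.sum_congr rfl fun j _ => ?_
    rw [complexQCoeff, if_neg h]
    push_cast
    ring

lemma complexQCoeff_zero_pos (hd : 1 ≤ d) (p q : ℕ) : 0 < complexQCoeff d p q 0 := by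
  rw [complexQCoeff]
  split_ifs with h
  · exact one_pos
  · have h1 : (0 : ℝ) < ((p + q + d - 1 : ℕ) : ℝ) := by
      rw [Nat.cast_pos]
      omega
    positivity

lemma complexQCoeff_succ (hd : 1 ≤ d) {p q j : ℕ} (hj : j < min p q) :
    complexQCoeff d p q (j + 1) * ((j + 1) * (d + p + q - j - 2 : ℕ)) +
      complexQCoeff d p q j * ((p - j : ℕ) * (q - j : ℕ)) = 0 := by
  obtain ⟨a, rfl⟩ : ∃ a, p = j + 1 + a := Nat.exists_eq_add_of_le (by omega)
  obtain ⟨b, rfl⟩ : ∃ b, q = j + 1 + b := Nat.exists_eq_add_of_le (by omega)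
  obtain ⟨d, rfl⟩ : ∃ e, d = 1 + e := Nat.exists_eq_add_of_le hd
  rw [complexQCoeff, complexQCoeff, if_neg (by omega), if_neg (by omega),
    show j + 1 + a - (j + 1) = a by omega, show j + 1 + b - (j + 1) = b by omega,
    show j + 1 + a - j = a + 1 by omega, show j + 1 + b - j = b + 1 by omega,
    show 1 + d + (j + 1 + a) + (j + 1 + b) - j - 2 = d + j + a + b + 1 by omega,
    show 1 + d + (j + 1 + a) + (j + 1 + b) - (j + 1) - 2 = d + j + a + b by omega,
    Nat.factorial_succ (d + j + a + b), Nat.factorial_succ j, Nat.factorial_succ a, Nat.factorial_succ b]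
  have h1 : (j.factorial : ℝ) ≠ 0 := by positivity
  have h2 : (a.factorial : ℝ) ≠ 0 := by positivity
  have h3 : (b.factorial : ℝ) ≠ 0 := by positivity
  have h4 : (j + 1 : ℝ) ≠ 0 := by positivity
  have h5 : (a + 1 : ℝ) ≠ 0 := by positivity
  have h6 : (b + 1 : ℝ) ≠ 0 := by positivity
  have h7 : ((1 + d - 1).factorial : ℝ) ≠ 0 := by positivity
  push_cast
  field_simp
  ring

/-- The coefficients of the linear form `⟨z, w⟩`. -/
def holForm (w : UnitSphere ℂ d) : Fin d ⊕ Fin d → ℂ :=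
  Sum.elim (fun i => starRingEnd ℂ (w.1 i)) (fun _ => 0)

/-- The coefficients of the linear form `conj ⟨z, w⟩`. -/
def antiForm (w : UnitSphere ℂ d) : Fin d ⊕ Fin d → ℂ :=
  Sum.elim (fun _ => 0) (fun i => w.1 i)

lemma aeval_linForm_holForm (z w : UnitSphere ℂ d) :
    aeval (complexCoord d z) (linForm (holForm w)) = inner ℂ w.1 z.1 := by
  rw [aeval_linForm, Fintype.sum_sum_type, inner_eq_sum_complex]
  simp [holForm, complexCoord]

lemma aeval_linForm_antiForm (z w : UnitSphere ℂ d) :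
    aeval (complexCoord d z) (linForm (antiForm w)) = starRingEnd ℂ (inner ℂ w.1 z.1) := by
  rw [aeval_linForm, Fintype.sum_sum_type, inner_eq_sum_complex]
  simp [antiForm, complexCoord]

/-- The polynomial `⟨z, w⟩^p conj ⟨z, w⟩^q` in `z` and `z̄`. -/
def formPow (w : UnitSphere ℂ d) (p q : ℕ) : MvPolynomial (Fin d ⊕ Fin d) ℂ :=
  linForm (holForm w) ^ p * linForm (antiForm w) ^ q

lemma formPow_mem_bihomogeneous (w : UnitSphere ℂ d) (p q : ℕ) :
    formPow w p q ∈ bihomogeneous d p q := by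
  have h1 : (linForm (holForm w)).IsWeightedHomogeneous (holWeight d) 1 :=
    isWeightedHomogeneous_linForm fun s hs => by
      rcases s with i | i
      · rfl
      · exact absurd rfl hs
  have h2 : (linForm (holForm w)).IsWeightedHomogeneous (antiWeight d) 0 :=
    isWeightedHomogeneous_linForm fun s hs => by
      rcases s with i | i
      · rfl
      · exact absurd rfl hs
  have h3 : (linForm (antiForm w)).IsWeightedHomogeneous (holWeight d) 0 :=
    isWeightedHomogeneous_linForm fun s hs => by
      rcases s with i | i
      · exact absurd rfl hs
      · rfl
  have h4 : (linForm (antiForm w)).IsWeightedHomogeneous (antiWeight d) 1 :=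
    isWeightedHomogeneous_linForm fun s hs => by
      rcases s with i | i
      · exact absurd rfl hs
      · rfl
  rw [mem_bihomogeneous]
  have e1 := (h1.pow p).mul (h3.pow q)
  have e2 := (h2.pow p).mul (h4.pow q)
  simp only [smul_eq_mul, mul_one, mul_zero, add_zero, zero_add] at e1 e2
  exact ⟨e1, e2⟩

/-- The first form involves only `z` and the second only `z̄`, so a mixed derivative hits each once;
the sum of the coefficients is `‖w‖² = 1`. -/
lemma lap_formPow (w : UnitSphere ℂ d) (p q : ℕ) :
    lap ℂ Sum.swap (formPow w p q) =
      ((2 * p * q : ℕ) : ℂ) • formPow w (p - 1) (q - 1) := by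
  have hs : ∀ i, (holForm w (Sum.inl i)) * antiForm w (Sum.inr i) =
      starRingEnd ℂ (w.1 i) * w.1 i := fun _ => rfl
  have hd1 : ∀ i, pderiv (Sum.inr i) (linForm (holForm w)) = 0 := fun i => by
    rw [pderiv_linForm]
    exact C_0
  have hd2 : ∀ i, pderiv (Sum.inl i) (linForm (antiForm w)) = 0 := fun i => by
    rw [pderiv_linForm]
    exact C_0
  have hL : lap ℂ Sum.swap (formPow w p q) =
      2 * ∑ i, pderiv (Sum.inl i) (pderiv (Sum.inr i) (formPow w p q)) := by
    rw [lap_swap]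
    simp [complexLaplacian, ← C_mul', map_ofNat]
  have hterm : ∀ i, pderiv (Sum.inl i) (pderiv (Sum.inr i) (formPow w p q)) =
      (p * q : MvPolynomial (Fin d ⊕ Fin d) ℂ) * formPow w (p - 1) (q - 1) *
        C (starRingEnd ℂ (w.1 i) * w.1 i) := fun i => by
    have hq : pderiv (Sum.inl i) (q : MvPolynomial (Fin d ⊕ Fin d) ℂ) = 0 := by
      rw [← map_natCast C, pderiv_C]
    simp only [formPow, pderiv_mul, pderiv_pow, hd1, hd2, pderiv_linForm, mul_zero, zero_mul,
      zero_add, add_zero, hq, pderiv_C, ← hs, C_mul]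
    ring
  rw [hL, Finset.sum_congr rfl fun i _ => hterm i, ← Finset.mul_sum, ← map_sum,
    sum_conj_mul_self, C_1, Nat.cast_smul_eq_nsmul, nsmul_eq_mul]
  push_cast
  ring

lemma fischer_formPow (w : UnitSphere ℂ d) (p q : ℕ) {g : MvPolynomial (Fin d ⊕ Fin d) ℂ}
    (hg : g ∈ bihomogeneous d p q) :
    fischer (formPow w p q) g = p.factorial * q.factorial * aeval (complexCoord d w) g := by
  have hhol : ∀ s, starRingEnd ℂ (holForm w s) = holWeight d s * complexCoord d w s := fun s => by
    rcases s with i | i <;> simp [holForm, holWeight, complexCoord]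
  have hanti : ∀ s, starRingEnd ℂ (antiForm w s) = antiWeight d s * complexCoord d w s :=
    fun s => by
      rcases s with i | i <;> simp [antiForm, antiWeight, complexCoord]
  rw [mem_bihomogeneous] at hg
  induction p generalizing g with
  | zero =>
    induction q generalizing g with
    | zero =>
      have h0 := isHomogeneous_of_mem_bihomogeneous (mem_bihomogeneous.2 hg)
      simpa [formPow] using fischer_one_left h0 (complexCoord d w)
    | succ q ih =>
      have h1 : formPow w 0 (q + 1) = linForm (antiForm w) * formPow w 0 q := by
        rw [formPow, formPow]
        ring
      rw [h1, fischer_linForm_mul, ih, aeval_dirDeriv hanti hg.2, Nat.factorial_succ]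
      · push_cast
        ring
      · refine ⟨isWeightedHomogeneous_dirDeriv hg.1 fun s hs => ?_,
          isWeightedHomogeneous_dirDeriv hg.2 fun s hs => ?_⟩
        · rcases s with i | i
          · exact absurd rfl hs
          · rfl
        · rcases s with i | i
          · exact absurd rfl hs
          · rfl
  | succ p ih =>
    have h1 : formPow w (p + 1) q = linForm (holForm w) * formPow w p q := by
      rw [formPow, formPow]
      ring
    rw [h1, fischer_linForm_mul, ih, aeval_dirDeriv hhol hg.1, Nat.factorial_succ]
    · push_cast
      ring
    · refine ⟨isWeightedHomogeneous_dirDeriv hg.1 fun s hs => ?_,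
        isWeightedHomogeneous_dirDeriv hg.2 fun s hs => ?_⟩
      · rcases s with i | i
        · rfl
        · exact absurd rfl hs
      · rcases s with i | i
        · rfl
        · exact absurd rfl hs

/-- The zonal harmonic of bidegree `(p,q)` with pole `w`. -/
def complexZonal (d : ℕ) (i : ℕ × ℕ) (w : UnitSphere ℂ d) : MvPolynomial (Fin d ⊕ Fin d) ℂ :=
  -- The factor `1 / 2^j` compensates for `quad = 2` on the sphere.
  ∑ j ∈ Finset.range (min i.1 i.2 + 1), ((complexQCoeff d i.1 i.2 j : ℂ) / 2 ^ j) •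
    (quad ℂ Sum.swap ^ j * formPow w (i.1 - j) (i.2 - j))

lemma complexZonal_mem (hd : 1 ≤ d) (i : ℕ × ℕ) (w : UnitSphere ℂ d) :
    complexZonal d i w ∈ biharmonics d i := by
  obtain ⟨p, q⟩ := i
  constructor
  · refine Submodule.sum_mem _ fun j hj => Submodule.smul_mem _ _ ?_
    have hf := mem_bihomogeneous.1 (formPow_mem_bihomogeneous w (p - j) (q - j))
    have e1 := ((isWeightedHomogeneous_quad_hol (d := d)).pow j).mul hf.1
    have e2 := ((isWeightedHomogeneous_quad_anti (d := d)).pow j).mul hf.2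
    rw [Finset.mem_range] at hj
    simp only at hj
    rw [smul_eq_mul, mul_one, show j + (p - j) = p by omega] at e1
    rw [smul_eq_mul, mul_one, show j + (q - j) = q by omega] at e2
    exact mem_bihomogeneous.2 ⟨e1, e2⟩
  · change lap ℂ Sum.swap (complexZonal d (p, q) w) = 0
    rw [complexZonal, lap_sum_quad_pow involutive_swap
      (g := fun j => formPow w (p - j) (q - j)) (n := fun j => (p - j) + (q - j))
      (d := fun j => ((2 * (p - j) * (q - j) : ℕ) : ℂ))
      (fun j _ => isHomogeneous_of_mem_bihomogeneous (formPow_mem_bihomogeneous _ _ _))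
      (fun j _ => by
        rw [lap_formPow]
        rfl)
      (fun j hj => ?_)]
    -- In the last term one of the two exponents is zero, so its Laplacian vanishes.
    · have : 2 * (p - min p q) * (q - min p q) = 0 := by
        rcases le_total p q with h | h
        · rw [min_eq_left h, Nat.sub_self, mul_zero, zero_mul]
        · rw [min_eq_right h, Nat.sub_self, mul_zero]
      simp only [this, Nat.cast_zero, mul_zero, zero_smul]
    · have h := congrArg (fun x : ℝ => (x : ℂ)) (complexQCoeff_succ hd hj)
      simp only [lt_min_iff] at hj
      have e : (j + 1) * (2 * Fintype.card (Fin d ⊕ Fin d) +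
          4 * (p - (j + 1) + (q - (j + 1))) + 4 * j) = 4 * ((j + 1) * (d + p + q - j - 2)) := by
        rw [Fintype.card_sum, Fintype.card_fin, mul_left_comm 4]
        congr 1
        omega
      simp only [e]
      push_cast at h ⊢
      field_simp
      linear_combination 4 * 2 ^ j * h

lemma aeval_complexZonal (i : ℕ × ℕ) (z w : UnitSphere ℂ d) :
    aeval (complexCoord d z) (complexZonal d i w) = complexQ d i.1 i.2 (inner ℂ w.1 z.1) := by
  rw [complexQ_eq_sum, complexZonal, map_sum]
  refine Finset.sum_congr rfl fun j _ => ?_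
  rw [map_smul, map_mul, map_pow, aeval_complexCoord_quad, formPow, map_mul, map_pow, map_pow,
    aeval_linForm_holForm, aeval_linForm_antiForm, smul_eq_mul]
  field_simp

instance finiteDimensional_biharmonics (i : ℕ × ℕ) : FiniteDimensional ℂ (biharmonics d i) :=
  Submodule.finiteDimensional_of_le (biharmonics_le i)

/-- The kernel `Q_{pq}(⟨z,w⟩)`. -/
def complexKernel (d : ℕ) (i : ℕ × ℕ) (z w : UnitSphere ℂ d) : ℂ :=
  complexQ d i.1 i.2 (inner ℂ w.1 z.1)

lemma isKernelOf_complexKernel (hd : 1 ≤ d) (i : ℕ × ℕ) :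
    IsKernelOf (complexHarmPair d i) (complexKernel d i) := by
  have h := isKernelOf_of_reproducing (biharmonics d i) (complexCoord d) (complexZonal d i)
    (complexZonal_mem hd i) (C := complexQCoeff d i.1 i.2 0 * (i.1.factorial * i.2.factorial))
    (mul_pos (complexQCoeff_zero_pos hd _ _) (by positivity)) (fun y h hh => by
      rw [complexZonal, fischer_sum_quad_pow (q := fun j => (complexQCoeff d i.1 i.2 j : ℂ) / 2 ^ j)
        (g := fun j => formPow y (i.1 - j) (i.2 - j)) hh.2, Nat.sub_zero, Nat.sub_zero,
        fischer_formPow _ _ _ hh.1]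
      simp [mul_assoc])
  simp only [aeval_complexZonal] at h
  rw [complexHarmPair_eq]
  exact h

lemma complexKernel_mul_mem (hd : 1 ≤ d) (a b : ℕ × ℕ) :
    complexKernel d a * complexKernel d b ∈ Submodule.span ℝ (Set.range (complexKernel d)) := by
  let p : ℕ × ℕ → UnitSphere ℂ d → UnitSphere ℂ d → ℂ := fun n z w =>
    (inner ℂ w.1 z.1) ^ n.1 * starRingEnd ℂ (inner ℂ w.1 z.1) ^ n.2
  have hK : ∀ a : ℕ × ℕ, complexKernel d a = ∑ j ∈ Finset.range (min a.1 a.2 + 1),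
      complexQCoeff d a.1 a.2 j • p (a.1 - j, a.2 - j) := fun a => by
    ext z w
    simp only [complexKernel, complexQ_eq_sum, p, Finset.sum_apply, Pi.smul_apply,
      Complex.real_smul]
  -- Lower terms of `Q_{nm}` reduce both exponents together, so induction on the first one suffices.
  have hp : ∀ n m, p (n, m) ∈ Submodule.span ℝ (Set.range (complexKernel d)) := fun n => by
    induction n using Nat.strong_induction_on with
    | _ n ih =>
      intro m
      have h1 := hK (n, m)
      rw [Finset.sum_range_succ', Nat.sub_zero, Nat.sub_zero] at h1
      have h2 : p (n, m) = (complexQCoeff d n m 0)⁻¹ • (complexKernel d (n, m) -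
          ∑ j ∈ Finset.range (min n m),
            complexQCoeff d n m (j + 1) • p (n - (j + 1), m - (j + 1))) := by
        rw [h1, add_sub_cancel_left, smul_smul, inv_mul_cancel₀ (complexQCoeff_zero_pos hd n m).ne',
          one_smul]
      rw [h2]
      refine Submodule.smul_mem _ _ (Submodule.sub_mem _
        (Submodule.subset_span (Set.mem_range_self _)) (Submodule.sum_mem _ fun j hj =>
          Submodule.smul_mem _ _ (ih _ ?_ _)))
      rw [Finset.mem_range] at hj
      omega
  refine mul_mem_span_of_monomials (p := p) (fun a b => ?_) (fun a => ?_) (fun n => hp n.1 n.2) a b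
  · ext z w
    simp only [p, Prod.fst_add, Prod.snd_add, pow_add, Pi.mul_apply]
    ring
  · rw [hK]
    exact Submodule.sum_mem _ fun j _ =>
      Submodule.smul_mem _ _ (Submodule.subset_span (Set.mem_range_self _))

/-! #### Products of monomials in two complex variables -/

/-- The monomial `z_a^p z̄_a^s z_b^r z̄_b^q`. -/
def planeMonomial (a b : Fin d) (p s r q : ℕ) : MvPolynomial (Fin d ⊕ Fin d) ℂ :=
  X (Sum.inl a) ^ p * X (Sum.inr a) ^ s * (X (Sum.inl b) ^ r * X (Sum.inr b) ^ q)

lemma planeMonomial_mem (a b : Fin d) (p s r q : ℕ) :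
    planeMonomial a b p s r q ∈ bihomogeneous d (p + r) (s + q) := by
  have h : ∀ (w : Fin d ⊕ Fin d → ℕ), (planeMonomial a b p s r q).IsWeightedHomogeneous w
      (p • w (Sum.inl a) + s • w (Sum.inr a) + (r • w (Sum.inl b) + q • w (Sum.inr b))) := fun w =>
    (((isWeightedHomogeneous_X ℂ w _).pow p).mul ((isWeightedHomogeneous_X ℂ w _).pow s)).mul
      (((isWeightedHomogeneous_X ℂ w _).pow r).mul ((isWeightedHomogeneous_X ℂ w _).pow q))
  rw [mem_bihomogeneous]
  have h1 := h (holWeight d)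
  have h2 := h (antiWeight d)
  simp only [holWeight, antiWeight, Sum.elim_inl, Sum.elim_inr, smul_eq_mul, mul_one, mul_zero,
    add_zero, zero_add] at h1 h2
  exact ⟨h1, h2⟩

lemma lap_planeMonomial {a b : Fin d} (hab : a ≠ b) (p s r q : ℕ) :
    lap ℂ Sum.swap (planeMonomial a b p s r q) =
      ((2 * (p * s) : ℕ) : ℂ) • planeMonomial a b (p - 1) (s - 1) r q +
        ((2 * (r * q) : ℕ) : ℂ) • planeMonomial a b p s (r - 1) (q - 1) := by
  classical
  have hX : ∀ {s t : Fin d ⊕ Fin d}, t ≠ s → pderiv s (X t : MvPolynomial _ ℂ) = 0 := fun h =>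
    pderiv_X_of_ne h
  have hc : ∀ (s : Fin d ⊕ Fin d) (n : ℕ), pderiv s (n : MvPolynomial (Fin d ⊕ Fin d) ℂ) = 0 :=
    fun s n => by rw [← map_natCast C, pderiv_C]
  have hL : lap ℂ Sum.swap (planeMonomial a b p s r q) =
      2 * ∑ i, pderiv (Sum.inl i) (pderiv (Sum.inr i) (planeMonomial a b p s r q)) := by
    rw [lap_swap]
    simp [complexLaplacian, ← C_mul', map_ofNat]
  have h0 : ∀ i, i ≠ a → i ≠ b →
      pderiv (Sum.inl i) (pderiv (Sum.inr i) (planeMonomial a b p s r q)) = 0 := by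
    intro i hia hib
    have : pderiv (Sum.inr i) (planeMonomial a b p s r q) = 0 := by
      have h1 : (Sum.inr a : Fin d ⊕ Fin d) ≠ Sum.inr i := fun h => hia (Sum.inr_injective h).symm
      have h2 : (Sum.inr b : Fin d ⊕ Fin d) ≠ Sum.inr i := fun h => hib (Sum.inr_injective h).symm
      simp [planeMonomial, hX h1, hX h2,
        hX (Sum.inl_ne_inr (a := a) (b := i)), hX (Sum.inl_ne_inr (a := b) (b := i))]
    rw [this, map_zero]
  have ha : pderiv (Sum.inl a) (pderiv (Sum.inr a) (planeMonomial a b p s r q)) =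
      (p * s : MvPolynomial (Fin d ⊕ Fin d) ℂ) * planeMonomial a b (p - 1) (s - 1) r q := by
    have h1 : (Sum.inr b : Fin d ⊕ Fin d) ≠ Sum.inr a := fun h => hab (Sum.inr_injective h).symm
    have h2 : (Sum.inl b : Fin d ⊕ Fin d) ≠ Sum.inl a := fun h => hab (Sum.inl_injective h).symm
    simp only [planeMonomial, pderiv_mul, pderiv_pow, hX h1, hX h2, pderiv_X_self, hc,
      hX (Sum.inl_ne_inr (a := a) (b := a)), hX (Sum.inl_ne_inr (a := b) (b := a)),
      hX (Sum.inr_ne_inl (a := a) (b := a)), hX (Sum.inr_ne_inl (a := a) (b := b)), mul_zero,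
      zero_mul, add_zero, zero_add, mul_one]
    ring
  have hb : pderiv (Sum.inl b) (pderiv (Sum.inr b) (planeMonomial a b p s r q)) =
      (r * q : MvPolynomial (Fin d ⊕ Fin d) ℂ) * planeMonomial a b p s (r - 1) (q - 1) := by
    have h1 : (Sum.inr a : Fin d ⊕ Fin d) ≠ Sum.inr b := fun h => hab (Sum.inr_injective h)
    have h2 : (Sum.inl a : Fin d ⊕ Fin d) ≠ Sum.inl b := fun h => hab (Sum.inl_injective h)
    simp only [planeMonomial, pderiv_mul, pderiv_pow, hX h1, hX h2, pderiv_X_self, hc,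
      hX (Sum.inl_ne_inr (a := b) (b := b)), hX (Sum.inl_ne_inr (a := a) (b := b)),
      hX (Sum.inr_ne_inl (a := b) (b := b)), hX (Sum.inr_ne_inl (a := b) (b := a)), mul_zero,
      zero_mul, add_zero, zero_add, mul_one]
    ring
  have hsum := Finset.sum_subset (Finset.subset_univ {a, b}) fun i _ hi => by
    simp only [Finset.mem_insert, Finset.mem_singleton, not_or] at hi
    exact h0 i hi.1 hi.2
  rw [hL, ← hsum, Finset.sum_pair hab, ha, hb]
  simp only [Nat.cast_smul_eq_nsmul, nsmul_eq_mul]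
  push_cast
  ring

/-- The Laplacian of such a monomial is a combination of two others with coefficients in `ℕ`, so
nothing cancels at a point where all of them equal `1`. While `min p s + min r q` is positive, some
conjugate pair can still be lowered. -/
lemma exists_aeval_lap_iterate_planeMonomial {a b : Fin d} (hab : a ≠ b)
    {v : Fin d ⊕ Fin d → ℂ} (hv : ∀ p s r q, aeval v (planeMonomial a b p s r q) = 1)
    (j p s r q : ℕ) :
    ∃ n : ℕ, aeval v ((lap ℂ Sum.swap ^ j) (planeMonomial a b p s r q)) = n ∧
      (j ≤ min p s + min r q → 0 < n) := by
  induction j generalizing p s r q with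
  | zero => exact ⟨1, by simp [hv], fun _ => one_pos⟩
  | succ j ih =>
    obtain ⟨n₁, h₁, h₁'⟩ := ih (p - 1) (s - 1) r q
    obtain ⟨n₂, h₂, h₂'⟩ := ih p s (r - 1) (q - 1)
    refine ⟨2 * (p * s) * n₁ + 2 * (r * q) * n₂, ?_, fun hj => ?_⟩
    · rw [pow_succ, Module.End.mul_apply, lap_planeMonomial hab, map_add, map_add, map_smul,
        map_smul, map_smul, map_smul, h₁, h₂]
      push_cast
      rfl
    · by_cases h : 0 < p ∧ 0 < s
      · have hn := h₁' (by omega)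
        have := h.1
        have := h.2
        positivity
      · have hr : 0 < r := by omega
        have hq : 0 < q := by omega
        have hn := h₂' (by omega)
        positivity

/-- The witnesses `z_a^p z̄_b^q` and `z̄_a^s z_b^r` are harmonic because neither contains a variable
together with its conjugate; in their product the conjugate pairs meet and the Laplacians act. -/
lemma exists_mul_notMem_complexHarm (hd : 3 ≤ d) (k l m : ℕ × ℕ) (hm : m ∈ complexIndexMul k l) :
    ∃ f ∈ complexHarmPair d k, ∃ g ∈ complexHarmPair d l,
      f * g ∉ ⨆ n ≠ m, complexHarmPair d n := by
  have : Nonempty (Fin d) := ⟨⟨0, by omega⟩⟩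
  obtain ⟨j, hj, hm⟩ := hm
  obtain ⟨p, q⟩ := k
  obtain ⟨r, s⟩ := l
  simp only at hj hm
  let a : Fin d := ⟨0, by omega⟩
  let b : Fin d := ⟨1, by omega⟩
  let c : Fin d := ⟨2, by omega⟩
  have hab : a ≠ b := by simp [a, b]
  have hac : a ≠ c := by simp [a, c]
  have hbc : b ≠ c := by simp [b, c]
  have hmem : ∀ p s r q, p * s = 0 → r * q = 0 →
      restrict (complexCoord d) (planeMonomial a b p s r q) ∈ complexHarmPair d (p + r, s + q) := by
    intro p s r q h1 h2
    rw [complexHarmPair_eq]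
    refine Submodule.mem_map_of_mem ⟨planeMonomial_mem a b p s r q, ?_⟩
    change lap ℂ Sum.swap _ = 0
    rw [lap_planeMonomial hab, h1, h2]
    simp
  have hf := hmem p 0 0 q (mul_zero _) (zero_mul _)
  have hg := hmem 0 s r 0 (zero_mul _) (mul_zero _)
  rw [add_zero, zero_add] at hf hg
  refine ⟨_, hf, _, hg, fun h => ?_⟩
  have hprod : planeMonomial a b p 0 0 q * planeMonomial a b 0 s r 0 =
      planeMonomial a b p s r q := by
    simp only [planeMonomial, pow_zero]
    ring
  rw [← restrict_mul, hprod] at h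
  have hP := planeMonomial_mem a b p s r q
  rw [add_comm s q] at hP
  have hm1 : m.1 + j = p + r := by rw [hm]; simp only; omega
  have hm2 : m.2 + j = q + s := by rw [hm]; simp only; omega
  obtain ⟨R, hR⟩ := quad_dvd_of_restrict_mem_complexHarm (N := (p + r, q + s)) hm1 hm2 hP h
  -- The four variables used take the value `1`, contributing `1 + 1` to `∑ z_i z̄_i`; the third
  -- coordinate contributes `1 * (-2)`. Such a zero of the form needs `z` and `z̄` to be
  -- independent.
  let v : Fin d ⊕ Fin d → ℂ := Sum.elim (Pi.single a 1 + Pi.single b 1 + Pi.single c 1)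
    (Pi.single a 1 + Pi.single b 1 + Pi.single c (-2))
  have hv : ∀ p s r q, aeval v (planeMonomial a b p s r q) = 1 := fun p s r q => by
    simp [planeMonomial, v, hab, hab.symm, hac, hbc]
  have hvi : ∀ i, v (Sum.inl i) * v (Sum.inr i) =
      (if i = a then 1 else 0) + (if i = b then 1 else 0) + (if i = c then -2 else 0) := fun i => by
    by_cases h1 : i = a
    · simp [v, h1, hab, hac]
    · by_cases h2 : i = b
      · simp [v, h2, hab.symm, hbc]
      · by_cases h3 : i = c
        · simp [v, h3, hac.symm, hbc.symm]
        · simp [v, h1, h2, h3]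
  have hs1 : ∑ i, v (Sum.inl i) * v (Sum.inr i) = 0 := by
    simp only [hvi, Finset.sum_add_distrib, Finset.sum_ite_eq', Finset.mem_univ, if_true]
    norm_num
  have hs2 : ∑ i, v (Sum.inr i) * v (Sum.inl i) = 0 := by
    rw [← hs1]
    exact Finset.sum_congr rfl fun i _ => mul_comm _ _
  have hquad : aeval v (quad ℂ (Sum.swap : Fin d ⊕ Fin d → _)) = 0 := by
    rw [quad, map_sum, Fintype.sum_sum_type]
    simp only [map_mul, aeval_X, Sum.swap_inl, Sum.swap_inr, hs1, hs2, add_zero]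
  obtain ⟨n, hn, hn'⟩ := exists_aeval_lap_iterate_planeMonomial hab hv j p s r q
  rw [hR, map_mul, hquad, zero_mul] at hn
  have := hn' (by omega)
  have h0 : n = 0 := by exact_mod_cast hn.symm
  omega

lemma givesComplexPotential_iff (F : ℂ → ℂ) (P : Submodule ℂ (UnitSphere ℂ d → ℂ)) :
    GivesComplexPotential d F P ↔ GivesPotential (complexHarmPair d) (complexKernel d)
      (fun z w => F (inner ℂ w.1 z.1)) P := by
  refine exists_congr fun f => and_congr_right fun _ => and_congr_left fun _ => ?_
  have h : ∀ z w : UnitSphere ℂ d, Finsupp.linearCombination ℝ (complexKernel d) f z w =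
      f.sum fun i c => (c : ℂ) * complexQ d i.1 i.2 (inner ℂ w.1 z.1) := fun z w => by
    simp [Finsupp.linearCombination_apply, Finsupp.sum, complexKernel]
  refine ⟨fun hF => ?_, fun hF z w => ?_⟩
  · ext z w
    rw [hF, h]
  · rw [← h, ← hF]

theorem complexPotential_mul (hd : 1 ≤ d) {F G : ℂ → ℂ} {U V : Set (ℕ × ℕ)}
    (hF : GivesComplexPotential d F (complexSpace d U))
    (hG : GivesComplexPotential d G (complexSpace d V)) :
    ∃ P : Submodule ℂ (UnitSphere ℂ d → ℂ), GivesComplexPotential d (fun z => F z * G z) P ∧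
      P ≤ complexSpace d (complexIndexProd U V) ∧
      (3 ≤ d → P = complexSpace d (complexIndexProd U V)) := by
  have : Nonempty (Fin d) := ⟨⟨0, hd⟩⟩
  simp only [givesComplexPotential_iff] at hF hG ⊢
  obtain ⟨P, h1, h2, h3⟩ := GivesPotential.mul (isKernelOf_complexKernel hd) iSupIndep_complexHarm
    (complexKernel_mul_mem hd) mul_mem_complexHarm hF hG
  exact ⟨P, h1, h2, fun h => h3 (exists_mul_notMem_complexHarm h)⟩

end Complex

end SphericalPotential

end

theorem mainTheorem11 :
    (∀ (d : ℕ) (_ : 1 ≤ d) (F G : ℝ → ℝ) (U V : Set ℕ),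
      SphericalPotential.GivesRealPotential d F (SphericalPotential.realSpace d U) →
      SphericalPotential.GivesRealPotential d G (SphericalPotential.realSpace d V) →
      ∃ P : Submodule ℝ (SphericalPotential.UnitSphere ℝ d → ℝ),
        SphericalPotential.GivesRealPotential d (fun x => F x * G x) P ∧
        P ≤ SphericalPotential.realSpace d (SphericalPotential.realIndexProd U V) ∧
        (3 ≤ d → P = SphericalPotential.realSpace d (SphericalPotential.realIndexProd U V))) ∧
    (∀ (d : ℕ) (_ : 1 ≤ d) (F G : ℂ → ℂ) (U V : Set (ℕ × ℕ)),
      SphericalPotential.GivesComplexPotential d F (SphericalPotential.complexSpace d U) →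
      SphericalPotential.GivesComplexPotential d G (SphericalPotential.complexSpace d V) →
      ∃ P : Submodule ℂ (SphericalPotential.UnitSphere ℂ d → ℂ),
        SphericalPotential.GivesComplexPotential d (fun z => F z * G z) P ∧
        P ≤ SphericalPotential.complexSpace d (SphericalPotential.complexIndexProd U V) ∧
        (3 ≤ d → P = SphericalPotential.complexSpace d
          (SphericalPotential.complexIndexProd U V))) :=
  ⟨fun _ hd _ _ _ _ hF hG => SphericalPotential.realPotential_mul hd hF hG,
    fun _ hd _ _ _ _ hF hG => SphericalPotential.complexPotential_mul hd hF hG⟩
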